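/- For a compact set $K\subset\mathbb C$ with more than one point whose complement in the Riemann sphere is simply connected, let $\varphi_K$ be the conformal mapping of the complement of $K$ onto $\{w:|w|>1\}\cup\{\infty\}$ with $\varphi_K(\infty)=\infty$ and $\varphi_K'(\infty)=\lim_{z\to\infty}\varphi_K(z)/z>0$. For $R>1$ let $\Gamma_{K,R}=\varphi_K^{-1}(\{|w|=R\})$, let $G_{K,R}$ be the bounded domain enclosed by $\Gamma_{K,R}$, let $\ell(\Gamma_{K,R})$ be the length of the curve $\Gamma_{K,R}$, and let $d(K,\Gamma_{K,R})$ be the distance between $K$ and $\Gamma_{K,R}$. For every $m$ there is a constant $C(m)>0$, depending only on $m$, such that the following holds. Let $K_1,\ldots,K_m\subset\mathbb C$ be compact sets, each with more than one point, whose complements in the Riemann sphere are simply connected. Let $R>1$ and let $f$ be an analytic function on a neighborhood of the closure of $G_{K_1,R}\times\cdots\times G_{K_m,R}$. Then for every integer $N\ge 0$ and every $R'\in(1,R)$ there is a polynomial $P_N\in\mathbb C[z_1,\ldots,z_m]$ of total degree at most $N$ such that $$\sup\{|f(z)-P_N(z)|: z\in K_1\times\cdots\times K_m\}\le C(m)\left(\frac{R'}{R}\right)^N\left(\prod_{i=1}^m\frac{\ell(\Gamma_{K_i,R'})}{d(K_i,\Gamma_{K_i,R'})}\right)\sup\{|f(z)|: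 z\in G_{K_1,R}\times\cdots\times G_{K_m,R}\}.$$ -/

import Mathlib

open Set Filter Topology

noncomputable section

/-- `φ` is the conformal mapping of the complement of `K` (on the Riemann sphere) onto the complement
`{1 < |w|} ∪ {∞}` of the closed unit disk, normalized by `φ(∞) = ∞` and `φ'(∞) > 0`, where
`φ'(∞) = lim_{z → ∞} φ(z) / z`. Only the values of `φ` off `K` matter. -/
structure IsExteriorMap (K : Set ℂ) (φ : ℂ → ℂ) : Prop where
  differentiableOn : DifferentiableOn ℂ φ Kᶜ
  bijOn : BijOn φ Kᶜ {w : ℂ | 1 < ‖w‖}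
  normalized : ∃ c : ℝ, 0 < c ∧ Tendsto (fun z : ℂ => φ z / z) (Bornology.cobounded ℂ) (𝓝 (c : ℂ))

/-- The normalized conformal mapping `φ_K` of the complement of `K` onto the complement of the closed
unit disk (an arbitrary function if there is none). -/
def exteriorMap (K : Set ℂ) : ℂ → ℂ :=
  Classical.epsilon (IsExteriorMap K)

/-- The inverse mapping `φ_K⁻¹`, from the complement of the closed unit disk to the complement
of `K`. -/
def exteriorInv (K : Set ℂ) : ℂ → ℂ :=
  Function.invFunOn (exteriorMap K) Kᶜ

/-- The level curve `Γ_{K,R} = φ_K⁻¹({|w| = R})`. -/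
def levelCurve (K : Set ℂ) (R : ℝ) : Set ℂ :=
  {z : ℂ | z ∉ K ∧ ‖exteriorMap K z‖ = R}

/-- The bounded domain `G_{K,R}` enclosed by `Γ_{K,R}`: the points off the curve whose connected
component in the complement of the curve is bounded. -/
def levelDomain (K : Set ℂ) (R : ℝ) : Set ℂ :=
  {z : ℂ | z ∉ levelCurve K R ∧
    Bornology.IsBounded (connectedComponentIn (levelCurve K R)ᶜ z)}

/-- The length of `Γ_{K,R}`: the total variation (supremum of the lengths of inscribed polygons) of
its parametrization `t ↦ φ_K⁻¹(R e^{it})`, `0 ≤ t ≤ 2π`. -/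
def levelCurveLength (K : Set ℂ) (R : ℝ) : ℝ :=
  (eVariationOn (fun t : ℝ => exteriorInv K ((R : ℂ) * Complex.exp ((t : ℂ) * Complex.I)))
    (Icc 0 (2 * Real.pi))).toReal

/-- The distance `d(A, B) = inf {|a - b| : a ∈ A, b ∈ B}` between two sets. -/
def setDist (A B : Set ℂ) : ℝ :=
  sInf (image2 dist A B)

end

/-!
The constant `C(m) = 1` works. Write `φᵢ` for the exterior map of `Kᵢ`.

*Existence of `φᵢ`.* The exterior map is only given by a choice function, so the Riemann mapping
theorem is needed. It is proved by maximizing the derivative at a point over the injective maps into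
the disc (`exists_riemannMap`); simple connectedness enters through the square roots of nonvanishing
functions. An inversion transports it to the complement of `Kᵢ` on the sphere
(`isExteriorMap_exteriorMap`). The bounded domain `G_{K,R}` is then identified with
`levelInterior K R`, the union of `K` with `{‖φ‖ < R}`.

*Integral formula.* Cauchy's formula over the level curve of radius `r < R`, written in the
coordinate `w = φ ζ`, represents `F z` for `z ∈ K` as the mean of `F (φ⁻¹ w) * levelKernel K z w`
over `‖w‖ = r` (`circleAverage_mul_levelKernel`). The kernel has mean modulus at most `ℓ / d` on the
circle of radius `r` (`circleAverage_norm_levelKernel_le`). It expands in Faber polynomials,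
`∑ₙ Fₙ(z) w⁻ⁿ` with `Fₙ` of degree at most `n` (`exists_faberPolynomials`).

*Approximation.* Iterating the formula over the torus of a radius `r` slightly smaller than `R` and
expanding the product of the kernels gives `f z = ∑ₙ Bₙ(z)`, where `Bₙ` is a polynomial of total
degree at most `n`. With `ρ = R' / r`, the function `∑ₙ Bₙ(z) (w / ρ)ⁿ` of `‖w‖ = 1` is an integral
of `f` against the kernels on the torus of radius `R'`, hence bounded by `sup |f| ∏ ℓᵢ / dᵢ`.
Truncating the series at `N` would cost a factor `1 / (1 - ρ)`. Instead
`P_N = ∑_{n ≤ N} (1 - ρ ^ (2 (N + 1 - n))) Bₙ` is used, for which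
`f - P_N = ρ ^ (N + 1) ∑ₙ ρ ^ |n - N - 1| Bₙ ρ⁻ⁿ`. The multiplier `ρ ^ |n - N - 1|` is convolution
with a rotated Poisson kernel, which has norm one (`norm_tsum_mul_pow_dist_le`). So
`|f - P_N| ≤ ρ ^ (N + 1) sup |f| ∏ ℓᵢ / dᵢ`, and letting `r` be close enough to `R` turns
`ρ ^ (N + 1)` into `(R' / R) ^ N`.
-/

/-! ### Injective holomorphic functions -/

theorem nhds_le_map_nhds_of_injOn {f : ℂ → ℂ} {U : Set ℂ} (hU : IsOpen U)
    (hf : DifferentiableOn ℂ f U) (hinj : InjOn f U) {z : ℂ} (hz : z ∈ U) :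
    𝓝 (f z) ≤ map f (𝓝 z) := by
  have hUz : U ∈ 𝓝 z := hU.mem_nhds hz
  rcases (hf.analyticAt hUz).eventually_constant_or_nhds_le_map_nhds with h | h
  · exfalso
    have h1 : ∀ᶠ w in 𝓝[≠] z, f w = f z ∧ w ∈ U :=
      ((h.and hUz).filter_mono nhdsWithin_le_nhds)
    obtain ⟨w, ⟨hw1, hw2⟩, hw3⟩ := (h1.and self_mem_nhdsWithin).exists
    exact hw3 (hinj hw2 hz hw1)
  · exact h

theorem isOpen_image_of_injOn {f : ℂ → ℂ} {U : Set ℂ} (hU : IsOpen U)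
    (hf : DifferentiableOn ℂ f U) (hinj : InjOn f U) : IsOpen (f '' U) := by
  rw [isOpen_iff_mem_nhds]
  rintro _ ⟨z, hz, rfl⟩
  exact nhds_le_map_nhds_of_injOn hU hf hinj hz (image_mem_map (hU.mem_nhds hz))

theorem tendsto_leftInverse_of_injOn {f g : ℂ → ℂ} {U : Set ℂ} (hU : IsOpen U)
    (hf : DifferentiableOn ℂ f U) (hinj : InjOn f U) (hg : ∀ z ∈ U, g (f z) = z) {z : ℂ}
    (hz : z ∈ U) : Tendsto g (𝓝 (f z)) (𝓝 z) := by
  refine (map_mono (nhds_le_map_nhds_of_injOn hU hf hinj hz)).trans ?_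
  rw [Filter.map_map]
  have : g ∘ f =ᶠ[𝓝 z] id := by
    filter_upwards [hU.mem_nhds hz] with w hw using hg w hw
  rw [Filter.map_congr this, Filter.map_id]

/-- The inverse of an injective holomorphic function is holomorphic: it is continuous by the open
mapping theorem, differentiable away from the (isolated) critical values, and the critical values
are removable. -/
theorem differentiableAt_leftInverse_of_injOn {f g : ℂ → ℂ} {U : Set ℂ} (hU : IsOpen U)
    (hf : DifferentiableOn ℂ f U) (hinj : InjOn f U) (hg : ∀ z ∈ U, g (f z) = z) {z : ℂ}
    (hz : z ∈ U) : DifferentiableAt ℂ g (f z) := by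
  have hUz : U ∈ 𝓝 z := hU.mem_nhds hz
  have hopen := isOpen_image_of_injOn hU hf hinj
  have hgt := tendsto_leftInverse_of_injOn hU hf hinj hg hz
  have hgz : g (f z) = z := hg z hz
  have hd : ∀ᶠ w in 𝓝[≠] z, deriv f w ≠ 0 := by
    rcases (hf.analyticAt hUz).deriv.eventually_eq_zero_or_eventually_ne_zero with h | h
    · exfalso
      obtain ⟨ε, hε, hb⟩ := Metric.eventually_nhds_iff_ball.1 (h.and hUz)
      have hc : ∀ w ∈ Metric.ball z ε, f w = f z := by
        intro w hw
        exact (convex_ball z ε).is_const_of_fderivWithin_eq_zero (𝕜 := ℂ)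
          (hf.mono fun y hy => (hb y hy).2) (fun y hy => by
            rw [fderivWithin_of_isOpen Metric.isOpen_ball hy]
            ext; simp [(hb y hy).1]) hw (Metric.mem_ball_self hε)
      have h1 : ∀ᶠ w in 𝓝[≠] z, w ∈ Metric.ball z ε :=
        nhdsWithin_le_nhds (Metric.ball_mem_nhds z hε)
      obtain ⟨w, hw1, hw3⟩ := (h1.and self_mem_nhdsWithin).exists
      exact hw3 (hinj (hb w hw1).2 hz (hc w hw1))
    · exact h
  refine (Complex.analyticAt_of_differentiable_on_punctured_nhds_of_continuousAt ?_
    (by rw [ContinuousAt, hgz]; exact hgt)).differentiableAt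
  have h1 : Tendsto g (𝓝[≠] (f z)) (𝓝[≠] z) := by
    refine tendsto_nhdsWithin_iff.2 ⟨hgt.mono_left nhdsWithin_le_nhds, ?_⟩
    filter_upwards [self_mem_nhdsWithin,
      nhdsWithin_le_nhds (hopen.mem_nhds (mem_image_of_mem f hz))] with y hy hy2 h
    obtain ⟨w, hw, rfl⟩ := hy2
    rw [hg w hw] at h
    exact hy (by rw [mem_singleton_iff.1 h]; rfl)
  filter_upwards [h1.eventually hd,
      nhdsWithin_le_nhds (hopen.mem_nhds (mem_image_of_mem f hz))] with y hy hy2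
  obtain ⟨w, hw, rfl⟩ := hy2
  rw [hg w hw] at hy
  refine (HasDerivAt.of_local_left_inverse (f := f) (f' := deriv f w) ?_ ?_ hy ?_).differentiableAt
  · rw [ContinuousAt, hg w hw]
    exact tendsto_leftInverse_of_injOn hU hf hinj hg hw
  · rw [hg w hw]
    exact (hf.differentiableAt (hU.mem_nhds hw)).hasDerivAt
  · filter_upwards [hopen.mem_nhds (mem_image_of_mem f hw)] with y hy
    obtain ⟨x, hx, rfl⟩ := hy
    rw [hg x hx]

theorem deriv_ne_zero_of_injOn {f : ℂ → ℂ} {U : Set ℂ} (hU : IsOpen U)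
    (hf : DifferentiableOn ℂ f U) (hinj : InjOn f U) {z : ℂ} (hz : z ∈ U) : deriv f z ≠ 0 := by
  have hg : ∀ w ∈ U, Function.invFunOn f U (f w) = w := fun w hw => hinj.leftInvOn_invFunOn hw
  have h1 := differentiableAt_leftInverse_of_injOn hU hf hinj hg hz
  have h2 := hf.differentiableAt (hU.mem_nhds hz)
  have h3 := h1.hasDerivAt.comp z h2.hasDerivAt
  have h4 : HasDerivAt (Function.invFunOn f U ∘ f) 1 z := by
    refine (hasDerivAt_id z).congr_of_eventuallyEq ?_
    filter_upwards [hU.mem_nhds hz] with w hw using hg w hw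
  intro h0
  have := h3.unique h4
  simp [h0] at this

/-! ### The Riemann mapping theorem -/

/-- A continuous square root of a nonvanishing holomorphic function is holomorphic. -/
theorem hasDerivAt_of_sq_eq {s h : ℂ → ℂ} {U : Set ℂ} (hU : IsOpen U)
    (hs : ContinuousOn s U) (hh : DifferentiableOn ℂ h U) (hsq : ∀ z ∈ U, s z ^ 2 = h z)
    (h0 : ∀ z ∈ U, h z ≠ 0) {z : ℂ} (hz : z ∈ U) :
    HasDerivAt s (deriv h z / (2 * s z)) z := by
  have hs0 : ∀ z ∈ U, s z ≠ 0 := fun z hz h => h0 z hz (by rw [← hsq z hz, h]; simp)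
  have hUz := hU.mem_nhds hz
  have hsc : Tendsto s (𝓝[≠] z) (𝓝 (s z)) :=
    (hs.continuousAt hUz).tendsto.mono_left nhdsWithin_le_nhds
  have hd := (hh.differentiableAt hUz).hasDerivAt
  rw [hasDerivAt_iff_tendsto_slope] at hd ⊢
  have h2 : Tendsto (fun w => s w + s z) (𝓝[≠] z) (𝓝 (2 * s z)) := by
    rw [two_mul]; exact hsc.add_const _
  have h2' : 2 * s z ≠ 0 := mul_ne_zero two_ne_zero (hs0 z hz)
  refine (hd.div h2 h2').congr' ?_
  filter_upwards [h2.eventually_ne h2', nhdsWithin_le_nhds hUz] with w hw hwU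
  simp only [slope_def_field, ← hsq w hwU, ← hsq z hz, Pi.div_apply]
  field_simp
  ring

/-- The disc automorphism `z ↦ (z - a) / (1 - conj a * z)`, which sends `a` to `0`. -/
noncomputable def discAut (a z : ℂ) : ℂ := (z - a) / (1 - starRingEnd ℂ a * z)

theorem discAut_denom_ne_zero {a z : ℂ} (ha : ‖a‖ < 1) (hz : ‖z‖ < 1) :
    1 - starRingEnd ℂ a * z ≠ 0 := by
  intro h
  have h1 : ‖starRingEnd ℂ a * z‖ = 1 := by
    rw [← sub_eq_zero.1 h]; simp
  rw [norm_mul, RCLike.norm_conj] at h1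
  nlinarith [norm_nonneg a, norm_nonneg z]

theorem norm_discAut_lt_one {a z : ℂ} (ha : ‖a‖ < 1) (hz : ‖z‖ < 1) : ‖discAut a z‖ < 1 := by
  have h0 := discAut_denom_ne_zero ha hz
  rw [discAut, norm_div, div_lt_one (norm_pos_iff.2 h0), ← sq_lt_sq₀ (norm_nonneg _) (norm_nonneg _),
    ← Complex.normSq_eq_norm_sq, ← Complex.normSq_eq_norm_sq]
  have h1 : Complex.normSq a < 1 := by
    rw [Complex.normSq_eq_norm_sq]; nlinarith [norm_nonneg a]
  have h2 : Complex.normSq z < 1 := by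
    rw [Complex.normSq_eq_norm_sq]; nlinarith [norm_nonneg z]
  have h3 : Complex.normSq (1 - starRingEnd ℂ a * z) - Complex.normSq (z - a)
      = (1 - Complex.normSq a) * (1 - Complex.normSq z) := by
    simp [Complex.normSq_apply]; ring
  nlinarith

theorem discAut_injOn {a : ℂ} (ha : ‖a‖ < 1) : InjOn (discAut a) (Metric.ball 0 1) := by
  intro z hz w hw h
  rw [mem_ball_zero_iff] at hz hw
  rw [discAut, discAut, div_eq_div_iff (discAut_denom_ne_zero ha hz)
    (discAut_denom_ne_zero ha hw)] at h
  have h1 : (z - w) * (1 - starRingEnd ℂ a * a) = 0 := by linear_combination h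
  rcases mul_eq_zero.1 h1 with h2 | h2
  · exact sub_eq_zero.1 h2
  · exact absurd h2 (discAut_denom_ne_zero ha ha)

theorem hasDerivAt_discAut {a z : ℂ} (ha : ‖a‖ < 1) (hz : ‖z‖ < 1) :
    HasDerivAt (discAut a)
      ((1 - starRingEnd ℂ a * a) / (1 - starRingEnd ℂ a * z) ^ 2) z := by
  have h0 := discAut_denom_ne_zero ha hz
  have h := ((hasDerivAt_id z).sub_const a).div
    (((hasDerivAt_id z).const_mul (starRingEnd ℂ a)).const_sub 1) h0
  refine HasDerivAt.congr_deriv h ?_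
  simp only [id]
  congr 1
  ring

/-- The competitors in the extremal problem that characterizes the Riemann map of `U`: injective
holomorphic maps into the unit disc that vanish at `z₀`. -/
def discMaps (U : Set ℂ) (z₀ : ℂ) : Set (ℂ → ℂ) :=
  {f | DifferentiableOn ℂ f U ∧ MapsTo f U (Metric.ball 0 1) ∧ InjOn f U ∧ f z₀ = 0}

theorem discMaps_nonempty {U : Set ℂ} (hU : IsOpen U) (hUc : IsSimplyConnected U)
    (hne : U ≠ univ) {z₀ : ℂ} (hz₀ : z₀ ∈ U) : (discMaps U z₀).Nonempty := by
  obtain ⟨a, ha⟩ := (ne_univ_iff_exists_notMem U).1 hne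
  have hza : ∀ z ∈ U, z - a ≠ 0 := fun z hz h => ha (sub_eq_zero.1 h ▸ hz)
  obtain ⟨s, hsc, hs⟩ := Complex.exists_continuousOn_pow_eq hUc hU (g := fun z => z - a)
    (by fun_prop) (by rintro ⟨z, hz, h⟩; exact hza z hz h) two_ne_zero
  have hsd : DifferentiableOn ℂ s U := fun z hz =>
    (hasDerivAt_of_sq_eq hU hsc (h := fun z => z - a) (by fun_prop) (fun z _ => hs z)
      hza hz).differentiableAt.differentiableWithinAt
  have hsi : InjOn s U := by
    intro z _ w _ h
    have := hs z
    rw [h, hs w] at this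
    linear_combination -this
  have hs0 : ∀ z ∈ U, s z ≠ 0 := fun z hz h => hza z hz (by rw [← hs z, h]; simp)
  -- the values `s z` and `-s z` are never both taken, so `-s z₀` is at a positive distance from
  -- the image of `s`
  obtain ⟨ε, hε, hball⟩ := Metric.isOpen_iff.1 (isOpen_image_of_injOn hU hsd hsi) (s z₀)
    (mem_image_of_mem s hz₀)
  have hfar : ∀ z ∈ U, ε ≤ ‖s z + s z₀‖ := by
    intro z hz
    by_contra! hlt
    obtain ⟨w, hw, hwz⟩ := hball (show -s z ∈ Metric.ball (s z₀) ε by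
      rwa [mem_ball_iff_norm, ← norm_neg, show -(-s z - s z₀) = s z + s z₀ by ring])
    have h1 : w = z := by
      have h2 := hs w
      rw [hwz, neg_sq, hs z] at h2
      linear_combination -h2
    subst h1
    exact hs0 w hw (by linear_combination hwz / 2)
  have hne0 : ∀ z ∈ U, s z + s z₀ ≠ 0 := fun z hz => norm_pos_iff.1 (hε.trans_le (hfar z hz))
  have hbd : ∀ z ∈ U, ‖(ε : ℂ) / 4 / (s z + s z₀)‖ ≤ 1 / 4 := by
    intro z hz
    rw [norm_div, div_le_iff₀ (hε.trans_le (hfar z hz))]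
    have : ‖(ε : ℂ) / 4‖ = ε / 4 := by simp [abs_of_pos hε]
    rw [this]
    linarith [hfar z hz]
  refine ⟨fun z => ε / 4 / (s z + s z₀) - ε / 4 / (s z₀ + s z₀), ?_, ?_, ?_, by simp⟩
  · exact ((differentiableOn_const _).div (hsd.add_const _) hne0).sub_const _
  · intro z hz
    rw [mem_ball_zero_iff]
    exact (norm_sub_le _ _).trans_lt (by linarith [hbd z hz, hbd z₀ hz₀])
  · intro z hz w hw h
    have h1 : (ε : ℂ) / 4 / (s z + s z₀) = ε / 4 / (s w + s z₀) := by simpa using h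
    rw [div_eq_div_iff (hne0 z hz) (hne0 w hw)] at h1
    have h2 : (ε : ℂ) / 4 ≠ 0 := by simp [hε.ne']
    exact hsi hz hw (by simpa using (mul_left_cancel₀ h2 h1).symm)

/-- A member of `discMaps` that omits a value `w` of the disc can be improved: composing with a disc
automorphism and a square root multiplies the derivative at `z₀` by `(1 + |w|) / (2 √|w|) > 1`. -/
theorem exists_discMaps_norm_deriv_lt {U : Set ℂ} (hU : IsOpen U) (hUc : IsSimplyConnected U)
    {z₀ : ℂ} (hz₀ : z₀ ∈ U) {f : ℂ → ℂ} (hf : f ∈ discMaps U z₀) {w : ℂ}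
    (hw : w ∈ Metric.ball (0 : ℂ) 1) (hwf : w ∉ f '' U) :
    ∃ F ∈ discMaps U z₀, ‖deriv f z₀‖ < ‖deriv F z₀‖ := by
  obtain ⟨hfd, hfm, hfi, hf0⟩ := hf
  rw [mem_ball_zero_iff] at hw
  have hfm' : ∀ z ∈ U, ‖f z‖ < 1 := fun z hz => mem_ball_zero_iff.1 (hfm hz)
  have hw0 : w ≠ 0 := fun h => hwf ⟨z₀, hz₀, by rw [hf0, h]⟩
  have hfD : ∀ z ∈ U, HasDerivAt f (deriv f z) z :=
    fun z hz => (hfd.differentiableAt (hU.mem_nhds hz)).hasDerivAt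
  set h : ℂ → ℂ := fun z => discAut w (f z) with hh
  have hhD : ∀ z ∈ U, HasDerivAt h
      ((1 - starRingEnd ℂ w * w) / (1 - starRingEnd ℂ w * f z) ^ 2 * deriv f z) z :=
    fun z hz => (hasDerivAt_discAut hw (hfm' z hz)).comp z (hfD z hz)
  have hhd : DifferentiableOn ℂ h U :=
    fun z hz => (hhD z hz).differentiableAt.differentiableWithinAt
  have hh0 : ∀ z ∈ U, h z ≠ 0 := by
    intro z hz h0
    rcases div_eq_zero_iff.1 h0 with h1 | h1
    · exact hwf ⟨z, hz, sub_eq_zero.1 h1⟩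
    · exact discAut_denom_ne_zero hw (hfm' z hz) h1
  obtain ⟨s, hsc, hs⟩ := Complex.exists_continuousOn_pow_eq hUc hU (g := h) hhd.continuousOn
    (by rintro ⟨z, hz, h⟩; exact hh0 z hz h) two_ne_zero
  have hsD : ∀ z ∈ U, HasDerivAt s (deriv h z / (2 * s z)) z := fun z hz =>
    hasDerivAt_of_sq_eq hU hsc hhd (fun z _ => hs z) hh0 hz
  have hs1 : ∀ z ∈ U, ‖s z‖ < 1 := by
    intro z hz
    have h1 : ‖s z‖ ^ 2 < 1 := by
      rw [← norm_pow, hs]; exact norm_discAut_lt_one hw (hfm' z hz)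
    exact (sq_lt_one_iff₀ (norm_nonneg _)).1 h1
  have hb := hs1 z₀ hz₀
  have hFD : ∀ z ∈ U, HasDerivAt (fun z => discAut (s z₀) (s z))
      ((1 - starRingEnd ℂ (s z₀) * s z₀) / (1 - starRingEnd ℂ (s z₀) * s z) ^ 2 *
        (deriv h z / (2 * s z))) z :=
    fun z hz => (hasDerivAt_discAut hb (hs1 z hz)).comp z (hsD z hz)
  refine ⟨fun z => discAut (s z₀) (s z),
    ⟨fun z hz => (hFD z hz).differentiableAt.differentiableWithinAt, fun z hz =>
      mem_ball_zero_iff.2 (norm_discAut_lt_one hb (hs1 z hz)), ?_, by simp [discAut]⟩, ?_⟩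
  · intro z hz y hy hzy
    have h1 := discAut_injOn hb (mem_ball_zero_iff.2 (hs1 z hz)) (mem_ball_zero_iff.2 (hs1 y hy)) hzy
    have h2 : h z = h y := by rw [← hs z, ← hs y, h1]
    exact hfi hz hy (discAut_injOn hw (hfm hz) (hfm hy) h2)
  · have hne : deriv f z₀ ≠ 0 := deriv_ne_zero_of_injOn hU hfd hfi hz₀
    rw [(hFD z₀ hz₀).deriv, (hhD z₀ hz₀).deriv, hf0]
    have hcj : ∀ a : ℂ, 1 - starRingEnd ℂ a * a = ((1 - ‖a‖ ^ 2 : ℝ) : ℂ) := by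
      intro a; rw [mul_comm, Complex.mul_conj, Complex.normSq_eq_norm_sq]; push_cast; ring
    have hsw : ‖s z₀‖ ^ 2 = ‖w‖ := by
      rw [← norm_pow, hs, hh]; simp [discAut, hf0]
    have hs0 : 0 < ‖s z₀‖ := by
      rcases (norm_nonneg (s z₀)).eq_or_lt with h | h
      · rw [← h] at hsw; exact absurd (norm_eq_zero.1 (by simpa using hsw.symm)) hw0
      · exact h
    rw [hcj, hcj]
    simp only [mul_zero, sub_zero, one_pow, div_one, norm_mul, norm_div, norm_pow,
      Complex.norm_real, RCLike.norm_ofNat, Real.norm_eq_abs]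
    rw [hsw, abs_of_pos (a := 1 - ‖w‖) (by linarith), abs_of_pos (a := 1 - ‖w‖ ^ 2)
      (by nlinarith [norm_nonneg w])]
    have hd : 0 < ‖deriv f z₀‖ := norm_pos_iff.2 hne
    rw [← hsw]
    rw [← hsw] at hw
    set b := ‖s z₀‖
    have e : (1 - b ^ 2) / (1 - b ^ 2) ^ 2 * ((1 - (b ^ 2) ^ 2) * ‖deriv f z₀‖ / (2 * b))
        = (1 + b ^ 2) / (2 * b) * ‖deriv f z₀‖ := by
      have : 1 - b ^ 2 ≠ 0 := by linarith
      field_simp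
      ring
    rw [e]
    have : 1 < (1 + b ^ 2) / (2 * b) := by
      rw [lt_div_iff₀ (by positivity)]
      nlinarith [sq_nonneg (1 - b), sq_pos_of_pos (sub_pos.2 hb)]
    nlinarith

/-- Hurwitz's theorem for injectivity: a locally uniform limit of injective holomorphic functions
on a connected open set is injective if its derivative does not vanish somewhere. If the limit `g`
took a value twice, at `a ≠ b`, then on a small disc about `b` the reciprocals of the zero-free
functions `f - f a` would violate the maximum modulus principle. -/
theorem injOn_of_tendstoLocallyUniformlyOn {l : Filter (ℂ → ℂ)} [l.NeBot] {g : ℂ → ℂ}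
    {U : Set ℂ} (hU : IsOpen U) (hUc : IsPreconnected U)
    (hl : ∀ᶠ f in l, DifferentiableOn ℂ f U ∧ InjOn f U)
    (hg : TendstoLocallyUniformlyOn (fun f z => f z) g l U) {z₀ : ℂ} (hz₀ : z₀ ∈ U)
    (hd : deriv g z₀ ≠ 0) : InjOn g U := by
  have hgd : DifferentiableOn ℂ g U := hg.differentiableOn (hl.mono fun f hf => hf.1) hU
  intro a ha b hb hab
  by_contra hne
  have hga : AnalyticOnNhd ℂ g U := hgd.analyticOnNhd hU
  have hiso : ∀ᶠ z in 𝓝[≠] b, g z ≠ g a := by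
    rcases (((hga b hb).sub analyticAt_const : AnalyticAt ℂ (fun z => g z - g a) b)
      ).eventually_eq_zero_or_eventually_ne_zero with h | h
    · exfalso
      have h1 : EqOn g (fun _ => g a) U :=
        hga.eqOn_of_preconnected_of_eventuallyEq analyticOnNhd_const hUc hb
          (h.mono fun z hz => sub_eq_zero.1 hz)
      apply hd
      have h2 : g =ᶠ[𝓝 z₀] fun _ => g a := by
        filter_upwards [hU.mem_nhds hz₀] with z hz using h1 hz
      rw [h2.deriv_eq]; simp
    · exact h.mono fun z hz => sub_ne_zero.1 hz
  obtain ⟨r, hr, hrs⟩ : ∃ r > 0, ∀ z ∈ Metric.closedBall b r, z ∈ U ∧ z ≠ a ∧ (z ≠ b → g z ≠ g a) := by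
    have h1 : ∀ᶠ z in 𝓝 b, z ∈ U ∧ z ≠ a ∧ (z ≠ b → g z ≠ g a) :=
      (show ∀ᶠ z in 𝓝 b, z ∈ U from hU.mem_nhds hb).and
        ((eventually_ne_nhds (Ne.symm hne)).and (eventually_nhdsWithin_iff.1 hiso))
    obtain ⟨r, hr, h⟩ := Metric.nhds_basis_closedBall.eventually_iff.1 h1
    exact ⟨r, hr, fun z hz => h hz⟩
  have hsub : Metric.closedBall b r ⊆ U := fun z hz => (hrs z hz).1
  obtain ⟨z₁, hz₁, hmin⟩ := (isCompact_sphere b r).exists_isMinOn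
    (NormedSpace.sphere_nonempty.2 hr.le)
    (f := fun z => ‖g z - g a‖)
    (((hgd.continuousOn.mono (Metric.sphere_subset_closedBall.trans hsub)).sub
      continuousOn_const).norm)
  set δ := ‖g z₁ - g a‖ with hδ
  have hδ0 : 0 < δ := norm_pos_iff.2 (sub_ne_zero.2
    ((hrs z₁ (Metric.sphere_subset_closedBall hz₁)).2.2 (by
      rintro rfl; simp at hz₁; exact hr.ne hz₁)))
  have hunif : TendstoUniformlyOn (fun (f : ℂ → ℂ) z => f z) g l (Metric.closedBall b r) :=
    (tendstoLocallyUniformlyOn_iff_tendstoUniformlyOn_of_compact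
      (isCompact_closedBall b r)).1 (hg.mono hsub)
  have hta := (hg.tendsto_at ha)
  obtain ⟨f, ⟨hfd, hfi⟩, hf1, hf2⟩ := (hl.and ((Metric.tendstoUniformlyOn_iff.1 hunif (δ / 4)
    (by positivity)).and (Metric.tendsto_nhds.1 hta (δ / 4) (by positivity)))).exists
  have hn0 : ∀ z ∈ Metric.closedBall b r, f z - f a ≠ 0 := fun z hz h =>
    (hrs z hz).2.1 (hfi (hrs z hz).1 ha (sub_eq_zero.1 h))
  have hcl : closure (Metric.ball b r) = Metric.closedBall b r := closure_ball b hr.ne'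
  have hdc : DiffContOnCl ℂ (fun z => (f z - f a)⁻¹) (Metric.ball b r) := by
    refine DifferentiableOn.diffContOnCl ?_
    rw [hcl]
    exact ((hfd.mono hsub).sub_const _).inv hn0
  have hmax := Complex.norm_le_of_forall_mem_frontier_norm_le (C := 2 / δ)
    Metric.isBounded_ball hdc (fun z hz => by
      rw [frontier_ball b hr.ne'] at hz
      have hzc := Metric.sphere_subset_closedBall hz
      rw [norm_inv, inv_le_comm₀ (norm_pos_iff.2 (hn0 z hzc)) (by positivity), inv_div]
      have h1 : δ ≤ ‖g z - g a‖ := hmin hz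
      have h2 := hf1 z hzc
      rw [dist_eq_norm] at h2 hf2
      have h3 : g z - g a = (g z - f z) + (f z - f a) + (f a - g a) := by ring
      have h4 := norm_add₃_le (a := g z - f z) (b := f z - f a) (c := f a - g a)
      rw [← h3] at h4
      linarith) (subset_closure (Metric.mem_ball_self hr))
  have hbc := Metric.mem_closedBall_self (x := b) hr.le
  rw [norm_inv, inv_le_comm₀ (norm_pos_iff.2 (hn0 b hbc)) (by positivity), inv_div] at hmax
  have h2 := hf1 b hbc
  rw [dist_eq_norm] at h2 hf2
  have h3 : f b - f a = -(g b - f b) - (f a - g a) := by rw [hab]; ring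
  have h4 := norm_sub_le (-(g b - f b)) (f a - g a)
  rw [← h3, norm_neg] at h4
  linarith

/-- A Montel-type compactness: along an ultrafilter of holomorphic maps into the unit disc, the
pointwise limit exists and the convergence is locally uniform, because the maps are locally
uniformly Lipschitz by the Schwarz lemma. -/
theorem exists_tendstoLocallyUniformlyOn_of_ultrafilter {U : Set ℂ} (hU : IsOpen U)
    (l : Ultrafilter (ℂ → ℂ))
    (hl : ∀ᶠ f in (l : Filter (ℂ → ℂ)), DifferentiableOn ℂ f U ∧ MapsTo f U (Metric.ball 0 1)) :
    ∃ g : ℂ → ℂ, TendstoLocallyUniformlyOn (fun f z => f z) g (l : Filter (ℂ → ℂ)) U ∧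
      MapsTo g U (Metric.closedBall 0 1) := by
  have h1 : ∀ z ∈ U, ∃ y ∈ Metric.closedBall (0 : ℂ) 1,
      Tendsto (fun f : ℂ → ℂ => f z) l (𝓝 y) := by
    intro z hz
    have := (isCompact_closedBall (0 : ℂ) 1).ultrafilter_le_nhds (l.map fun f : ℂ → ℂ => f z) (by
      rw [le_principal_iff, Ultrafilter.coe_map, mem_map]
      filter_upwards [hl] with f hf using Metric.ball_subset_closedBall (hf.2 hz))
    simpa [Tendsto, Ultrafilter.coe_map] using this
  choose! g hg1 hg2 using h1
  refine ⟨g, ?_, hg1⟩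
  rw [Metric.tendstoLocallyUniformlyOn_iff]
  intro ε hε x hx
  obtain ⟨r, hr, hb⟩ := Metric.isOpen_iff.1 hU x hx
  have hlip : ∀ᶠ f : ℂ → ℂ in (l : Filter (ℂ → ℂ)), ∀ y ∈ Metric.ball x r,
      dist (f y) (f x) ≤ 2 / r * dist y x := by
    filter_upwards [hl] with f hf y hy
    refine Complex.dist_le_div_mul_dist_of_mapsTo_ball (hf.1.mono hb) (fun z hz => ?_) hy
    rw [Metric.mem_closedBall]
    have e1 := Metric.mem_ball.1 (hf.2 (hb hz))
    have e2 := Metric.mem_ball.1 (hf.2 hx)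
    linarith [dist_triangle_right (f z) (f x) 0]
  have hlipg : ∀ y ∈ Metric.ball x r, dist (g y) (g x) ≤ 2 / r * dist y x := by
    intro y hy
    exact le_of_tendsto ((hg2 y (hb hy)).dist (hg2 x hx)) (hlip.mono fun f hf => hf y hy)
  refine ⟨Metric.ball x (min r (r / 2 * (ε / 3))),
    mem_nhdsWithin_of_mem_nhds (Metric.ball_mem_nhds _ (by positivity)), ?_⟩
  filter_upwards [hlip, Metric.tendsto_nhds.1 (hg2 x hx) (ε / 3) (by positivity)] with f hf1 hf2 y hy
  have hyr : y ∈ Metric.ball x r := Metric.ball_subset_ball (min_le_left _ _) hy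
  have hy2 : 2 / r * dist y x < ε / 3 := by
    have : dist y x < r / 2 * (ε / 3) := (Metric.mem_ball.1 hy).trans_le (min_le_right _ _)
    calc 2 / r * dist y x < 2 / r * (r / 2 * (ε / 3)) := by gcongr
      _ = ε / 3 := by field_simp
  have e1 := hf1 y hyr
  have e2 := hlipg y hyr
  have e3 := dist_triangle4 (g y) (g x) (f x) (f y)
  rw [dist_comm (g x) (f x), dist_comm (f x) (f y)] at e3
  linarith

/-- The **Riemann mapping theorem**. The map is an extremal function in `discMaps U z₀`, one of
maximal `|f' z₀|`. -/
theorem exists_riemannMap {U : Set ℂ} (hU : IsOpen U) (hUc : IsSimplyConnected U)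
    (hne : U ≠ univ) {z₀ : ℂ} (hz₀ : z₀ ∈ U) :
    ∃ f : ℂ → ℂ, DifferentiableOn ℂ f U ∧ BijOn f U (Metric.ball 0 1) ∧ f z₀ = 0 ∧
      ∃ c : ℝ, 0 < c ∧ deriv f z₀ = c := by
  have hpc : IsPreconnected U := hUc.isPathConnected.isConnected.isPreconnected
  suffices ∃ f ∈ discMaps U z₀, ∀ w ∈ Metric.ball (0 : ℂ) 1, w ∈ f '' U by
    obtain ⟨f, ⟨hfd, hfm, hfi, hf0⟩, hfs⟩ := this
    have hne := deriv_ne_zero_of_injOn hU hfd hfi hz₀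
    -- rotate so that the derivative becomes positive
    set c : ℂ := ‖deriv f z₀‖ / deriv f z₀ with hc
    have hc1 : ‖c‖ = 1 := by
      rw [hc, norm_div]; simp [norm_ne_zero_iff.2 hne]
    have hc0 : c ≠ 0 := norm_ne_zero_iff.1 (by rw [hc1]; exact one_ne_zero)
    refine ⟨fun z => c * f z, hfd.const_mul c, ⟨fun z hz => ?_, fun z hz w hw h => ?_,
      fun w hw => ?_⟩, by simp [hf0], ‖deriv f z₀‖, norm_pos_iff.2 hne, ?_⟩
    · simpa [hc1] using hfm hz
    · exact hfi hz hw (mul_left_cancel₀ hc0 h)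
    · obtain ⟨z, hz, hzw⟩ := hfs (w / c) (by simpa [hc1] using hw)
      exact ⟨z, hz, by simp only [hzw]; field_simp⟩
    · rw [deriv_const_mul _ (hfd.differentiableAt (hU.mem_nhds hz₀)), hc]
      field_simp
  -- a maximizer is the limit of competitors along an ultrafilter on which `‖f' z₀‖` tends to its
  -- supremum `S`
  have hbdd : BddAbove ((fun f : ℂ → ℂ => ‖deriv f z₀‖) '' discMaps U z₀) := by
    obtain ⟨r, hr, hb⟩ := Metric.isOpen_iff.1 hU z₀ hz₀
    refine ⟨1 / r, ?_⟩
    rintro _ ⟨f, ⟨hfd, hfm, hfi, hf0⟩, rfl⟩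
    refine Complex.norm_deriv_le_div_of_mapsTo_ball (hfd.mono hb) (fun z hz => ?_) hr
    rw [hf0]
    exact Metric.ball_subset_closedBall (hfm (hb hz))
  have hnonempty := (discMaps_nonempty hU hUc hne hz₀)
  set S := sSup ((fun f : ℂ → ℂ => ‖deriv f z₀‖) '' discMaps U z₀) with hS
  have hcl : S ∈ closure ((fun f : ℂ → ℂ => ‖deriv f z₀‖) '' discMaps U z₀) :=
    csSup_mem_closure (hnonempty.image _) hbdd
  have hnb : (comap (fun f : ℂ → ℂ => ‖deriv f z₀‖) (𝓝 S) ⊓ 𝓟 (discMaps U z₀)).NeBot := by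
    rw [inf_neBot_iff]
    rintro s ⟨t, ht, hts⟩ s' hs'
    obtain ⟨_, hy, f, hf, rfl⟩ := mem_closure_iff_nhds.1 hcl t ht
    exact ⟨f, hts hy, hs' hf⟩
  set l : Ultrafilter (ℂ → ℂ) :=
    @Ultrafilter.of _ (comap (fun f : ℂ → ℂ => ‖deriv f z₀‖) (𝓝 S) ⊓ 𝓟 (discMaps U z₀)) hnb
  have hle : (l : Filter (ℂ → ℂ)) ≤
      comap (fun f : ℂ → ℂ => ‖deriv f z₀‖) (𝓝 S) ⊓ 𝓟 (discMaps U z₀) :=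
    @Ultrafilter.of_le _ _ hnb
  have hmem : ∀ᶠ f in (l : Filter (ℂ → ℂ)), f ∈ discMaps U z₀ :=
    le_principal_iff.1 (hle.trans inf_le_right)
  have hderiv : Tendsto (fun f : ℂ → ℂ => ‖deriv f z₀‖) l (𝓝 S) :=
    tendsto_iff_comap.2 (hle.trans inf_le_left)
  obtain ⟨g, hg, hgm⟩ := exists_tendstoLocallyUniformlyOn_of_ultrafilter hU l
    (hmem.mono fun f hf => ⟨hf.1, hf.2.1⟩)
  have hgd : DifferentiableOn ℂ g U := hg.differentiableOn (hmem.mono fun f hf => hf.1) hU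
  have hg' : ‖deriv g z₀‖ = S := by
    have h1 := (hg.deriv (hmem.mono fun f hf => hf.1) hU).tendsto_at hz₀
    exact tendsto_nhds_unique h1.norm hderiv
  have hS0 : 0 < S := by
    obtain ⟨f, hf⟩ := hnonempty
    exact (norm_pos_iff.2 (deriv_ne_zero_of_injOn hU hf.1 hf.2.2.1 hz₀)).trans_le
      (le_csSup hbdd ⟨f, hf, rfl⟩)
  have hgd0 : deriv g z₀ ≠ 0 := norm_pos_iff.1 (hg' ▸ hS0)
  have hginj : InjOn g U :=
    injOn_of_tendstoLocallyUniformlyOn hU hpc (hmem.mono fun f hf => ⟨hf.1, hf.2.2.1⟩) hg hz₀ hgd0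
  have hg0 : g z₀ = 0 := by
    refine tendsto_nhds_unique (hg.tendsto_at hz₀) ?_
    exact tendsto_const_nhds.congr' (hmem.mono fun f hf => hf.2.2.2.symm)
  have hgb : MapsTo g U (Metric.ball 0 1) := by
    intro z hz
    by_contra hcon
    have h1 : ‖g z‖ = 1 := le_antisymm (mem_closedBall_zero_iff.1 (hgm hz))
      (by simpa using hcon)
    have h2 := Complex.norm_eqOn_of_isPreconnected_of_isMaxOn hpc hU hgd hz (fun y hy => by
      simp only [Function.comp_apply, mem_ofPred_eq, h1]
      exact mem_closedBall_zero_iff.1 (hgm hy)) hz₀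
    simp [hg0, h1] at h2
  have hgF : g ∈ discMaps U z₀ := ⟨hgd, hgb, hginj, hg0⟩
  refine ⟨g, hgF, fun w hw => ?_⟩
  by_contra hwg
  obtain ⟨F, hF, hlt⟩ := exists_discMaps_norm_deriv_lt hU hUc hz₀ hgF hw hwg
  rw [hg'] at hlt
  exact absurd (le_csSup hbdd ⟨F, hF, rfl⟩) (not_le.2 hlt)

/-! ### Existence of the exterior map -/

/-- The chart `u ↦ a + 1 / u` of the Riemann sphere, centred at `∞`. -/
noncomputable def sphereChart (a u : ℂ) : OnePoint ℂ :=
  if u = 0 then OnePoint.infty else ((a + u⁻¹ : ℂ) : OnePoint ℂ)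

theorem coclosedCompact_eq_cobounded : coclosedCompact ℂ = Bornology.cobounded ℂ := by
  rw [coclosedCompact_eq_cocompact, Metric.cobounded_eq_cocompact]

theorem tendsto_inv_sub_cobounded (a : ℂ) :
    Tendsto (fun z : ℂ => (z - a)⁻¹) (Bornology.cobounded ℂ) (𝓝 0) :=
  tendsto_inv₀_cobounded.comp (tendsto_sub_const_cobounded a)

theorem continuous_sphereChart (a : ℂ) : Continuous (sphereChart a) := by
  rw [continuous_iff_continuousAt]
  intro u
  by_cases hu : u = 0
  · subst hu
    have h0 : sphereChart a 0 = OnePoint.infty := if_pos rfl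
    have h1 : Tendsto (fun u : ℂ => a + u⁻¹) (𝓝[≠] 0) (coclosedCompact ℂ) := by
      rw [coclosedCompact_eq_cobounded]
      exact (tendsto_const_add_cobounded a).comp tendsto_inv₀_nhdsNE_zero
    have h2 : Tendsto (sphereChart a) (𝓝[≠] 0) (𝓝 OnePoint.infty) := by
      refine (OnePoint.tendsto_coe_infty.comp h1).congr' ?_
      filter_upwards [self_mem_nhdsWithin] with u hu
      exact (if_neg hu).symm
    rw [continuousAt_iff_punctured_nhds, h0]
    exact h2
  · have h1 : ContinuousAt (fun u : ℂ => ((a + u⁻¹ : ℂ) : OnePoint ℂ)) u :=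
      OnePoint.continuous_coe.continuousAt.comp (continuousAt_const.add (continuousAt_inv₀ hu))
    refine h1.congr ?_
    filter_upwards [eventually_ne_nhds hu] with v hv
    exact (if_neg hv).symm

theorem isEmbedding_sphereChart (a : ℂ) : IsEmbedding (sphereChart a) := by
  set p : OnePoint ℂ → ℂ := fun x => x.elim 0 (fun z => (z - a)⁻¹) with hp
  have hpc : ∀ u, p (sphereChart a u) = u := by
    intro u
    by_cases hu : u = 0
    · simp [sphereChart, hu, hp]
    · simp [sphereChart, hu, hp]
  have hpt : ∀ u, ContinuousAt p (sphereChart a u) := by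
    intro u
    by_cases hu : u = 0
    · rw [sphereChart, if_pos hu, OnePoint.continuousAt_infty', coclosedCompact_eq_cobounded]
      exact tendsto_inv_sub_cobounded a
    · rw [sphereChart, if_neg hu, OnePoint.continuousAt_coe]
      have : ContinuousAt (fun z : ℂ => (z - a)⁻¹) (a + u⁻¹) :=
        ContinuousAt.inv₀ (by fun_prop) (by simpa using hu)
      exact this
  refine ⟨isInducing_iff_nhds.2 fun u => le_antisymm
    ((continuous_sphereChart a).tendsto u).le_comap ?_, Function.LeftInverse.injective hpc⟩
  have h1 : Tendsto p (𝓝 (sphereChart a u)) (𝓝 u) := by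
    have := hpt u
    rwa [ContinuousAt, hpc] at this
  calc comap (sphereChart a) (𝓝 (sphereChart a u))
      ≤ comap (sphereChart a) (comap p (𝓝 u)) := comap_mono h1.le_comap
    _ = 𝓝 u := by
        rw [comap_comap, show p ∘ sphereChart a = id from funext hpc, comap_id]

/-- The exterior map of `K`: if `F` is the Riemann map of the image of the complement of `K` under
`z ↦ 1 / (z - a)`, where `a ∈ K`, it is `z ↦ 1 / F (1 / (z - a))`. -/
theorem exists_isExteriorMap {K : Set ℂ} (hK : IsCompact K) (hnt : K.Nontrivial)
    (hsc : IsSimplyConnected (((fun z : ℂ => (z : OnePoint ℂ)) '' K)ᶜ : Set (OnePoint ℂ))) :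
    ∃ φ, IsExteriorMap K φ := by
  obtain ⟨a, ha, b, hb, hab⟩ := hnt
  set V : Set (OnePoint ℂ) := ((fun z : ℂ => (z : OnePoint ℂ)) '' K)ᶜ with hV
  have hcoe : ∀ z : ℂ, (z : OnePoint ℂ) ∈ V ↔ z ∉ K := by
    intro z
    rw [hV, mem_compl_iff, not_iff_not]
    constructor
    · rintro ⟨y, hy, h⟩
      rwa [← OnePoint.coe_injective h]
    · exact fun h => ⟨z, h, rfl⟩
  have hVo : IsOpen V :=
    (hK.image OnePoint.continuous_coe).isClosed.isOpen_compl
  set U : Set ℂ := sphereChart a ⁻¹' V with hU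
  have hUo : IsOpen U := hVo.preimage (continuous_sphereChart a)
  have h0U : (0 : ℂ) ∈ U := by
    simp [hU, hV, sphereChart]
  have hmem : ∀ u : ℂ, u ≠ 0 → (u ∈ U ↔ a + u⁻¹ ∉ K) := by
    intro u hu
    rw [hU, mem_preimage, sphereChart, if_neg hu, hcoe]
  have himg : sphereChart a '' U = V := by
    rw [hU, image_preimage_eq_inter_range]
    refine inter_eq_left.2 fun x hx => ?_
    induction x using OnePoint.rec with
    | infty => exact ⟨0, if_pos rfl⟩
    | coe z =>
      have hza : z - a ≠ 0 := fun h => (hcoe z).1 hx (by rwa [sub_eq_zero.1 h])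
      refine ⟨(z - a)⁻¹, ?_⟩
      rw [sphereChart, if_neg (inv_ne_zero hza)]
      simp
  have hUc : IsSimplyConnected U := by
    rw [← (isEmbedding_sphereChart a).isSimplyConnected_image, himg]
    exact hsc
  have hne : U ≠ univ := by
    intro h
    have hba : b - a ≠ 0 := sub_ne_zero.2 hab.symm
    have := (hmem (b - a)⁻¹ (inv_ne_zero hba)).1 (h ▸ mem_univ _)
    exact this (by simpa using hb)
  obtain ⟨F, hFd, ⟨hFm, hFi, hFs⟩, hF0, c, hc, hFc⟩ := exists_riemannMap hUo hUc hne h0U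
  have hKa : ∀ z, z ∉ K → z - a ≠ 0 := fun z hz h => hz (by rwa [sub_eq_zero.1 h])
  have hKU : ∀ z, z ∉ K → (z - a)⁻¹ ∈ U := fun z hz =>
    (hmem _ (inv_ne_zero (hKa z hz))).2 (by simpa using hz)
  have hFne : ∀ z, z ∉ K → F (z - a)⁻¹ ≠ 0 := fun z hz h =>
    inv_ne_zero (hKa z hz) (hFi (hKU z hz) h0U (h.trans hF0.symm))
  refine ⟨fun z => (F (z - a)⁻¹)⁻¹, ?_, ⟨?_, ?_, ?_⟩, c⁻¹, inv_pos.2 hc, ?_⟩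
  · refine DifferentiableOn.inv ?_ hFne
    refine hFd.comp (DifferentiableOn.inv (by fun_prop) hKa) fun z hz => hKU z hz
  · intro z hz
    rw [mem_ofPred_eq, norm_inv, one_lt_inv_iff₀]
    exact ⟨norm_pos_iff.2 (hFne z hz), mem_ball_zero_iff.1 (hFm (hKU z hz))⟩
  · intro z hz y hy h
    have := hFi (hKU z hz) (hKU y hy) (inv_injective h)
    simpa using this
  · intro w hw
    rw [mem_ofPred_eq] at hw
    have hw0 : w ≠ 0 := norm_pos_iff.1 (one_pos.trans hw)
    obtain ⟨u, huU, hu⟩ := hFs (show w⁻¹ ∈ Metric.ball (0 : ℂ) 1 by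
      rw [mem_ball_zero_iff, norm_inv]; exact inv_lt_one_of_one_lt₀ hw)
    have hu0 : u ≠ 0 := by
      rintro rfl
      rw [hF0] at hu
      exact inv_ne_zero hw0 hu.symm
    exact ⟨a + u⁻¹, (hmem u hu0).1 huU, by simp [hu]⟩
  · have h1 := (hFd.differentiableAt (hUo.mem_nhds h0U)).hasDerivAt
    rw [hFc, hasDerivAt_iff_tendsto_slope] at h1
    have h2 : Tendsto (fun z : ℂ => (z - a)⁻¹) (Bornology.cobounded ℂ) (𝓝[≠] 0) := by
      refine tendsto_nhdsWithin_iff.2 ⟨tendsto_inv_sub_cobounded a, ?_⟩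
      filter_upwards [Metric.cobounded_eq_cocompact (α := ℂ) ▸ hK.compl_mem_cocompact] with z hz
      exact inv_ne_zero (hKa z hz)
    have h3 := (h1.comp h2).inv₀ (by exact_mod_cast hc.ne' : (c : ℂ) ≠ 0)
    have h4 : Tendsto (fun z : ℂ => 1 - a * z⁻¹) (Bornology.cobounded ℂ) (𝓝 (1 - a * 0)) :=
      (tendsto_inv₀_cobounded.const_mul a).const_sub 1
    have h5 := h3.mul h4
    simp only [mul_zero, sub_zero, mul_one] at h5
    push_cast
    refine h5.congr' ?_
    filter_upwards [Metric.cobounded_eq_cocompact (α := ℂ) ▸ hK.compl_mem_cocompact,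
      Bornology.eventually_ne_cobounded (0 : ℂ)] with z hz hz0
    have e1 := hKa z hz
    have e2 := hFne z hz
    simp only [Function.comp_apply, slope_def_field, hF0, sub_zero]
    field_simp

theorem isExteriorMap_exteriorMap {K : Set ℂ} (hK : IsCompact K) (hnt : K.Nontrivial)
    (hsc : IsSimplyConnected (((fun z : ℂ => (z : OnePoint ℂ)) '' K)ᶜ : Set (OnePoint ℂ))) :
    IsExteriorMap K (exteriorMap K) :=
  Classical.epsilon_spec (exists_isExteriorMap hK hnt hsc)

/-! ### The inverse of the exterior map and its level domains -/

section ExteriorInverse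

variable {K : Set ℂ}

theorem exteriorInv_notMem (h : IsExteriorMap K (exteriorMap K)) {w : ℂ} (hw : 1 < ‖w‖) :
    exteriorInv K w ∉ K :=
  h.bijOn.surjOn.mapsTo_invFunOn hw

theorem exteriorMap_exteriorInv (h : IsExteriorMap K (exteriorMap K)) {w : ℂ} (hw : 1 < ‖w‖) :
    exteriorMap K (exteriorInv K w) = w :=
  h.bijOn.surjOn.rightInvOn_invFunOn hw

theorem exteriorInv_exteriorMap (h : IsExteriorMap K (exteriorMap K)) {z : ℂ} (hz : z ∉ K) :
    exteriorInv K (exteriorMap K z) = z :=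
  h.bijOn.injOn.leftInvOn_invFunOn hz

theorem one_lt_norm_exteriorMap (h : IsExteriorMap K (exteriorMap K)) {z : ℂ} (hz : z ∉ K) :
    1 < ‖exteriorMap K z‖ :=
  h.bijOn.mapsTo hz

theorem isOpen_one_lt_norm : IsOpen {w : ℂ | 1 < ‖w‖} := isOpen_lt continuous_const continuous_norm

theorem injOn_exteriorInv (h : IsExteriorMap K (exteriorMap K)) :
    InjOn (exteriorInv K) {w : ℂ | 1 < ‖w‖} := by
  intro w hw v hv hwv
  rw [← exteriorMap_exteriorInv h hw, hwv, exteriorMap_exteriorInv h hv]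

theorem differentiableOn_exteriorInv (hK : IsCompact K) (h : IsExteriorMap K (exteriorMap K)) :
    DifferentiableOn ℂ (exteriorInv K) {w : ℂ | 1 < ‖w‖} := by
  intro w hw
  have h1 := differentiableAt_leftInverse_of_injOn hK.isClosed.isOpen_compl h.differentiableOn
    h.bijOn.injOn (g := exteriorInv K) (fun z hz => exteriorInv_exteriorMap h hz)
    (exteriorInv_notMem h hw)
  rw [exteriorMap_exteriorInv h hw] at h1
  exact h1.differentiableWithinAt

theorem eventually_cobounded_notMem (hK : IsCompact K) : ∀ᶠ z in Bornology.cobounded ℂ, z ∉ K :=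
  Metric.cobounded_eq_cocompact (α := ℂ) ▸ hK.compl_mem_cocompact

theorem tendsto_exteriorMap_cobounded (h : IsExteriorMap K (exteriorMap K)) :
    Tendsto (exteriorMap K) (Bornology.cobounded ℂ) (Bornology.cobounded ℂ) := by
  obtain ⟨c, hc, hlim⟩ := h.normalized
  rw [← tendsto_norm_atTop_iff_cobounded]
  have h1 : Tendsto (fun z : ℂ => ‖z‖ * ‖exteriorMap K z / z‖) (Bornology.cobounded ℂ) atTop :=
    tendsto_norm_cobounded_atTop.atTop_mul_pos (C := ‖(c : ℂ)‖) (by simpa using hc.ne') hlim.norm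
  refine h1.congr' ?_
  filter_upwards [Bornology.eventually_ne_cobounded (0 : ℂ)] with z hz
  rw [norm_div]
  field_simp

/-- `φ⁻¹` sends `∞` to `∞`: the function `u ↦ 1 / φ (1 / u)` is open at `0`, so every `w` near `∞`
is the value of `φ` at a point near `∞`. -/
theorem tendsto_exteriorInv_cobounded (hK : IsCompact K) (h : IsExteriorMap K (exteriorMap K)) :
    Tendsto (exteriorInv K) (Bornology.cobounded ℂ) (Bornology.cobounded ℂ) := by
  set χ : ℂ → ℂ := fun u => if u = 0 then 0 else (exteriorMap K u⁻¹)⁻¹ with hχ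
  have hinv : Tendsto (fun u : ℂ => u⁻¹) (𝓝[≠] 0) (Bornology.cobounded ℂ) :=
    tendsto_inv₀_nhdsNE_zero
  have hev : ∀ᶠ u in 𝓝[≠] (0 : ℂ), u⁻¹ ∉ K := hinv.eventually (eventually_cobounded_notMem hK)
  have hχ' : ∀ᶠ u in 𝓝[≠] (0 : ℂ), χ u = (exteriorMap K u⁻¹)⁻¹ := by
    filter_upwards [self_mem_nhdsWithin] with u hu using if_neg hu
  have hne : ∀ z, z ∉ K → exteriorMap K z ≠ 0 := fun z hz =>
    norm_pos_iff.1 (one_pos.trans (one_lt_norm_exteriorMap h hz))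
  have hχ0 : χ 0 = 0 := if_pos rfl
  have hcont : ContinuousAt χ 0 := by
    rw [continuousAt_iff_punctured_nhds, hχ0]
    exact (tendsto_inv₀_cobounded.comp ((tendsto_exteriorMap_cobounded h).comp hinv)).congr'
      (hχ'.mono fun u hu => hu.symm)
  have hdiff : ∀ᶠ u in 𝓝[≠] (0 : ℂ), DifferentiableAt ℂ χ u := by
    filter_upwards [hev, self_mem_nhdsWithin] with u hu hu0
    have h1 : DifferentiableAt ℂ (fun u : ℂ => (exteriorMap K u⁻¹)⁻¹) u := by
      refine DifferentiableAt.inv ?_ (hne _ hu)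
      exact (h.differentiableOn.differentiableAt (hK.isClosed.isOpen_compl.mem_nhds hu)).comp u
        (differentiableAt_inv hu0)
    refine h1.congr_of_eventuallyEq ?_
    filter_upwards [eventually_ne_nhds (show u ≠ 0 from hu0)] with v hv using if_neg hv
  have han := Complex.analyticAt_of_differentiable_on_punctured_nhds_of_continuousAt hdiff hcont
  have hopen : 𝓝 (0 : ℂ) ≤ map χ (𝓝 0) := by
    rcases han.eventually_constant_or_nhds_le_map_nhds with h1 | h1
    · exfalso
      obtain ⟨u, h2, h3, h4⟩ := ((h1.filter_mono nhdsWithin_le_nhds).and (hev.and hχ')).exists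
      rw [h4, hχ0] at h2
      exact inv_ne_zero (hne _ h3) h2
    · rwa [hχ0] at h1
  intro s hs
  rw [mem_map]
  have h1 : ∀ᶠ u in 𝓝[≠] (0 : ℂ), u⁻¹ ∈ s ∧ u⁻¹ ∉ K := (hinv.eventually hs).and hev
  rw [eventually_nhdsWithin_iff] at h1
  have h2 : Tendsto (fun w : ℂ => w⁻¹) (Bornology.cobounded ℂ) (map χ (𝓝 0)) :=
    tendsto_inv₀_cobounded.mono_right hopen
  filter_upwards [h2 (image_mem_map h1), Bornology.eventually_ne_cobounded (0 : ℂ)] with w hw hw0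
  obtain ⟨u, hu, huw⟩ := hw
  have hu0 : u ≠ 0 := by
    rintro rfl
    rw [hχ0] at huw
    exact inv_ne_zero hw0 huw.symm
  rw [hχ] at huw
  simp only [if_neg hu0, inv_inj] at huw
  rw [mem_preimage, ← huw, exteriorInv_exteriorMap h (hu hu0).2]
  exact (hu hu0).1

theorem exists_tendsto_exteriorInv_div (hK : IsCompact K) (h : IsExteriorMap K (exteriorMap K)) :
    ∃ b : ℂ, b ≠ 0 ∧ Tendsto (fun w => exteriorInv K w / w) (Bornology.cobounded ℂ) (𝓝 b) := by
  obtain ⟨c, hc, hlim⟩ := h.normalized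
  have hc' : (c : ℂ) ≠ 0 := by exact_mod_cast hc.ne'
  refine ⟨(c : ℂ)⁻¹, inv_ne_zero hc', ?_⟩
  refine ((hlim.comp (tendsto_exteriorInv_cobounded hK h)).inv₀ hc').congr' ?_
  filter_upwards [(tendsto_norm_cobounded_atTop (E := ℂ)).eventually_gt_atTop 1] with w hw
  simp only [Function.comp_apply, exteriorMap_exteriorInv h hw, inv_div]

/-- The domain `K ∪ {z : |φ z| < r}` inside the level curve. -/
def levelInterior (K : Set ℂ) (r : ℝ) : Set ℂ := {z | z ∉ K → ‖exteriorMap K z‖ < r}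

theorem subset_levelInterior (r : ℝ) : K ⊆ levelInterior K r := fun _ hz hz' => absurd hz hz'

theorem exteriorInv_mem_levelInterior (h : IsExteriorMap K (exteriorMap K)) {w : ℂ} {r : ℝ}
    (hw : 1 < ‖w‖) (hwr : ‖w‖ < r) : exteriorInv K w ∈ levelInterior K r := fun _ => by
  rwa [exteriorMap_exteriorInv h hw]

/-- Only a compact part of `{r ≤ ‖w‖}` is sent by `φ⁻¹` into a given bounded set. -/
theorem isClosed_exteriorInv_image (hK : IsCompact K) (h : IsExteriorMap K (exteriorMap K))
    {r : ℝ} (hr : 1 < r) : IsClosed (exteriorInv K '' {w | r ≤ ‖w‖}) := by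
  rw [isClosed_iff_nhds]
  intro z hz
  rw [← mem_closure_iff_nhds] at hz
  obtain ⟨ρ, hρ⟩ : ∃ ρ, ∀ w, ρ ≤ ‖w‖ → exteriorInv K w ∉ Metric.ball z 1 := by
    have h1 : ∀ᶠ w in Bornology.cobounded ℂ, exteriorInv K w ∉ Metric.ball z 1 :=
      (tendsto_exteriorInv_cobounded hK h).eventually
        (Bornology.isBounded_def.1 Metric.isBounded_ball)
    rw [← comap_norm_atTop, eventually_comap, eventually_atTop] at h1
    obtain ⟨ρ, hρ⟩ := h1
    exact ⟨ρ, fun w hw => hρ _ hw w rfl⟩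
  have hC : IsCompact (exteriorInv K '' ({w | r ≤ ‖w‖} ∩ Metric.closedBall 0 ρ)) := by
    refine IsCompact.image_of_continuousOn ((isCompact_closedBall _ _).inter_left
      (isClosed_le continuous_const continuous_norm)) ?_
    exact (differentiableOn_exteriorInv hK h).continuousOn.mono fun w hw => hr.trans_le hw.1
  have h2 : z ∈ closure (Metric.ball z 1 ∩ exteriorInv K '' {w | r ≤ ‖w‖}) :=
    Metric.isOpen_ball.inter_closure ⟨Metric.mem_ball_self one_pos, hz⟩
  have h3 : Metric.ball z 1 ∩ exteriorInv K '' {w | r ≤ ‖w‖} ⊆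
      exteriorInv K '' ({w | r ≤ ‖w‖} ∩ Metric.closedBall 0 ρ) := by
    rintro _ ⟨hy, w, hw, rfl⟩
    refine ⟨w, ⟨hw, ?_⟩, rfl⟩
    rw [mem_closedBall_zero_iff]
    by_contra! hlt
    exact hρ w hlt.le hy
  obtain ⟨w, hw, rfl⟩ := hC.isClosed.closure_subset (closure_mono h3 h2)
  exact ⟨w, hw.1, rfl⟩

theorem compl_levelInterior (h : IsExteriorMap K (exteriorMap K)) {r : ℝ} (hr : 1 < r) :
    (levelInterior K r)ᶜ = exteriorInv K '' {w | r ≤ ‖w‖} := by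
  ext z
  simp only [levelInterior, mem_compl_iff, mem_ofPred_eq, Classical.not_imp, not_lt, mem_image]
  constructor
  · rintro ⟨hz, hzr⟩
    exact ⟨_, hzr, exteriorInv_exteriorMap h hz⟩
  · rintro ⟨w, hw, rfl⟩
    have hw1 := hr.trans_le hw
    exact ⟨exteriorInv_notMem h hw1, by rwa [exteriorMap_exteriorInv h hw1]⟩

theorem isOpen_levelInterior (hK : IsCompact K) (h : IsExteriorMap K (exteriorMap K))
    {r : ℝ} (hr : 1 < r) : IsOpen (levelInterior K r) := by
  rw [← isClosed_compl_iff, compl_levelInterior h hr]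
  exact isClosed_exteriorInv_image hK h hr

theorem isBounded_levelInterior (hK : IsCompact K) (h : IsExteriorMap K (exteriorMap K))
    (r : ℝ) : Bornology.IsBounded (levelInterior K r) := by
  rw [Bornology.isBounded_def]
  filter_upwards [eventually_cobounded_notMem hK,
    (tendsto_norm_cobounded_atTop.comp (tendsto_exteriorMap_cobounded h)).eventually_ge_atTop r]
    with z hz hzr hzi
  exact absurd (hzi hz) (not_lt.2 hzr)

theorem isOpen_setOf_lt_exteriorMap (hK : IsCompact K) (h : IsExteriorMap K (exteriorMap K))
    (r : ℝ) : IsOpen {z | z ∉ K ∧ r < ‖exteriorMap K z‖} :=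
  h.differentiableOn.continuousOn.norm.isOpen_inter_preimage hK.isClosed.isOpen_compl isOpen_Ioi

/-- The level curve separates the plane into the bounded open set `levelInterior K r` and the open
set `{‖φ‖ > r}`, so a component that meets the former stays in it. -/
theorem levelInterior_subset_levelDomain (hK : IsCompact K) (h : IsExteriorMap K (exteriorMap K))
    {r : ℝ} (hr : 1 < r) : levelInterior K r ⊆ levelDomain K r := by
  intro z hz
  have hzc : z ∉ levelCurve K r := fun hc => (hz hc.1).ne hc.2
  refine ⟨hzc, (isBounded_levelInterior hK h r).subset ?_⟩
  refine isPreconnected_connectedComponentIn.subset_left_of_subset_union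
    (isOpen_levelInterior hK h hr) (isOpen_setOf_lt_exteriorMap hK h r) ?_ ?_
    ⟨z, mem_connectedComponentIn hzc, hz⟩
  · rw [Set.disjoint_left]
    exact fun y hy hy' => absurd (hy hy'.1) hy'.2.le.not_gt
  · intro y hy
    have hyc : y ∉ levelCurve K r := connectedComponentIn_subset _ _ hy
    by_cases hyK : y ∈ K
    · exact Or.inl (subset_levelInterior r hyK)
    · rcases lt_trichotomy ‖exteriorMap K y‖ r with h1 | h1 | h1
      · exact Or.inl fun _ => h1
      · exact absurd ⟨hyK, h1⟩ hyc
      · exact Or.inr ⟨hyK, h1⟩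

theorem isPreconnected_lt_norm {r : ℝ} (hr : 0 < r) : IsPreconnected {w : ℂ | r < ‖w‖} := by
  have : {w : ℂ | r < ‖w‖} =
      (fun p : ℝ × ℝ => (p.1 : ℂ) * Complex.exp (p.2 * Complex.I)) '' (Ioi r ×ˢ univ) := by
    ext w
    constructor
    · intro hw
      exact ⟨(‖w‖, w.arg), ⟨hw, trivial⟩, Complex.norm_mul_exp_arg_mul_I w⟩
    · rintro ⟨p, ⟨hp, -⟩, rfl⟩
      simp only [mem_Ioi] at hp
      simp [Complex.norm_exp_ofReal_mul_I, abs_of_pos (hr.trans hp), hp]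
  rw [this]
  exact (isPreconnected_Ioi.prod isPreconnected_univ).image _ (by fun_prop)

/-- The set `{‖φ‖ > r}` is connected and unbounded, so none of its points is in a bounded component
of the complement of the level curve. -/
theorem levelDomain_subset_levelInterior (hK : IsCompact K) (h : IsExteriorMap K (exteriorMap K))
    {r : ℝ} (hr : 1 < r) : levelDomain K r ⊆ levelInterior K r := by
  rintro z ⟨hzc, hbdd⟩ hzK
  by_contra! hzr
  have hlt : r < ‖exteriorMap K z‖ := hzr.lt_of_ne fun h' => hzc ⟨hzK, h'.symm⟩
  have h1 : IsPreconnected (exteriorInv K '' {w | r < ‖w‖}) :=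
    (isPreconnected_lt_norm (one_pos.trans hr)).image _
      ((differentiableOn_exteriorInv hK h).continuousOn.mono fun w hw => hr.trans hw)
  have h2 : exteriorInv K '' {w | r < ‖w‖} ⊆ connectedComponentIn (levelCurve K r)ᶜ z := by
    refine h1.subset_connectedComponentIn ⟨_, hlt, exteriorInv_exteriorMap h hzK⟩ ?_
    rintro _ ⟨w, hw, rfl⟩ ⟨-, hc⟩
    rw [exteriorMap_exteriorInv h (hr.trans hw)] at hc
    exact hw.ne' hc
  have h3 := (tendsto_exteriorInv_cobounded hK h).eventually
    (Bornology.isBounded_def.1 (hbdd.subset h2))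
  obtain ⟨w, hw1, hw2⟩ :=
    (h3.and ((tendsto_norm_cobounded_atTop (E := ℂ)).eventually_gt_atTop r)).exists
  exact hw1 ⟨w, hw2, rfl⟩

theorem isBounded_levelDomain (hK : IsCompact K) (h : IsExteriorMap K (exteriorMap K))
    {r : ℝ} (hr : 1 < r) : Bornology.IsBounded (levelDomain K r) :=
  (isBounded_levelInterior hK h r).subset (levelDomain_subset_levelInterior hK h hr)

theorem levelCurve_eq_image (h : IsExteriorMap K (exteriorMap K)) {r : ℝ} (hr : 1 < r) :
    levelCurve K r = exteriorInv K '' Metric.sphere 0 r := by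
  ext z
  constructor
  · rintro ⟨hz, hzr⟩
    exact ⟨_, mem_sphere_zero_iff_norm.2 hzr, exteriorInv_exteriorMap h hz⟩
  · rintro ⟨w, hw, rfl⟩
    rw [mem_sphere_zero_iff_norm] at hw
    have hw1 : 1 < ‖w‖ := hw ▸ hr
    exact ⟨exteriorInv_notMem h hw1, by rwa [exteriorMap_exteriorInv h hw1]⟩

theorem setDist_le {A B : Set ℂ} {a b : ℂ} (ha : a ∈ A) (hb : b ∈ B) : setDist A B ≤ ‖a - b‖ := by
  rw [← dist_eq_norm]
  exact csInf_le ⟨0, by rintro _ ⟨x, -, y, -, rfl⟩; exact dist_nonneg⟩ ⟨a, ha, b, hb, rfl⟩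

theorem setDist_levelCurve_pos (hK : IsCompact K) (hne : K.Nonempty)
    (h : IsExteriorMap K (exteriorMap K)) {r : ℝ} (hr : 1 < r) :
    0 < setDist K (levelCurve K r) := by
  have hc : IsCompact (levelCurve K r) := by
    rw [levelCurve_eq_image h hr]
    refine (isCompact_sphere _ _).image_of_continuousOn
      ((differentiableOn_exteriorInv hK h).continuousOn.mono fun w hw => ?_)
    rw [mem_sphere_zero_iff_norm] at hw
    exact hr.trans_eq hw.symm
  have hcne : (levelCurve K r).Nonempty := by
    rw [levelCurve_eq_image h hr]
    exact (NormedSpace.sphere_nonempty.2 (by linarith)).image _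
  have himg : IsCompact (image2 dist K (levelCurve K r)) := by
    rw [← image_prod]
    exact (hK.prod hc).image continuous_dist
  obtain ⟨x, hx, y, hy, hxy⟩ := himg.sInf_mem (hne.image2 hcne)
  rw [setDist, ← hxy]
  refine dist_pos.2 fun hxy' => ?_
  subst hxy'
  exact hy.1 hx

end ExteriorInverse

/-! ### Cauchy's formula on level domains -/

theorem differentiableOn_integral_div_sub {H γ : ℝ → ℂ} (hH : Continuous H) (hγ : Continuous γ)
    {V : Set ℂ} (hV : IsOpen V) (hd : ∀ θ, γ θ ∉ V) (a b : ℝ) :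
    DifferentiableOn ℂ (fun z => ∫ θ in a..b, H θ / (γ θ - z)) V := by
  intro z₀ hz₀
  obtain ⟨ε, hε, hb⟩ := Metric.isOpen_iff.1 hV z₀ hz₀
  have hfar : ∀ θ, ∀ z ∈ Metric.ball z₀ (ε / 2), ε / 2 ≤ ‖γ θ - z‖ := by
    intro θ z hz
    have h1 : ε ≤ dist (γ θ) z₀ := by
      by_contra! hlt
      exact hd θ (hb hlt)
    have h2 := dist_triangle (γ θ) z z₀
    rw [← dist_eq_norm]
    linarith [Metric.mem_ball.1 hz]
  have hne : ∀ θ, ∀ z ∈ Metric.ball z₀ (ε / 2), γ θ - z ≠ 0 := fun θ z hz =>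
    norm_pos_iff.1 ((half_pos hε).trans_le (hfar θ z hz))
  have hball : Metric.ball z₀ (ε / 2) ∈ 𝓝 z₀ := Metric.ball_mem_nhds _ (half_pos hε)
  have hz₀' : z₀ ∈ Metric.ball z₀ (ε / 2) := Metric.mem_ball_self (half_pos hε)
  have hcont : ∀ z ∈ Metric.ball z₀ (ε / 2), Continuous fun θ => H θ / (γ θ - z) := fun z hz =>
    hH.div (hγ.sub continuous_const) fun θ => hne θ z hz
  refine (intervalIntegral.hasDerivAt_integral_of_dominated_loc_of_deriv_le
    (F := fun z θ => H θ / (γ θ - z)) (F' := fun z θ => H θ / (γ θ - z) ^ 2)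
    (bound := fun θ => ‖H θ‖ / (ε / 2) ^ 2) hball ?_
    ((hcont z₀ hz₀').intervalIntegrable _ _) ?_ ?_ ?_ ?_).2.differentiableAt.differentiableWithinAt
  · filter_upwards [hball] with z hz using (hcont z hz).aestronglyMeasurable
  · exact (hH.div ((hγ.sub continuous_const).pow 2) fun θ =>
      pow_ne_zero 2 (hne θ z₀ hz₀')).aestronglyMeasurable
  · refine Eventually.of_forall fun θ _ z hz => ?_
    rw [norm_div, norm_pow]
    have := hfar θ z hz
    gcongr
  · exact (hH.norm.div_const _).intervalIntegrable _ _
  · refine Eventually.of_forall fun θ _ z hz => ?_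
    have h1 := ((hasDerivAt_id z).const_sub (γ θ)).fun_inv (hne θ z hz)
    have h2 := h1.const_mul (H θ)
    simp only [id, neg_neg, ← div_eq_mul_inv, mul_one_div] at h2
    exact h2

theorem tendsto_integral_div_sub_cobounded {H γ : ℝ → ℂ} (hH : Continuous H) (hγ : Continuous γ)
    (a b : ℝ) :
    Tendsto (fun z => ∫ θ in a..b, H θ / (γ θ - z)) (Bornology.cobounded ℂ) (𝓝 0) := by
  obtain ⟨A, hA⟩ := (isCompact_uIcc (a := a) (b := b)).exists_bound_of_continuousOn hH.continuousOn
  obtain ⟨B, hB⟩ := (isCompact_uIcc (a := a) (b := b)).exists_bound_of_continuousOn hγ.continuousOn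
  have hA0 : 0 ≤ A := (norm_nonneg _).trans (hA a left_mem_uIcc)
  have h1 : Tendsto (fun z : ℂ => A / (‖z‖ - B) * |b - a|) (Bornology.cobounded ℂ) (𝓝 0) := by
    have : Tendsto (fun z : ℂ => A / (‖z‖ - B)) (Bornology.cobounded ℂ) (𝓝 0) :=
      (tendsto_atTop_add_const_right _ (-B) tendsto_norm_cobounded_atTop).const_div_atTop A
    simpa using this.mul_const |b - a|
  refine squeeze_zero_norm' ?_ h1
  filter_upwards [(tendsto_norm_cobounded_atTop (E := ℂ)).eventually_gt_atTop B] with z hz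
  refine intervalIntegral.norm_integral_le_of_norm_le_const fun θ hθ => ?_
  have hθ' := uIoc_subset_uIcc hθ
  rw [norm_div]
  have h2 : ‖z‖ - B ≤ ‖γ θ - z‖ := by
    have := norm_sub_norm_le z (γ θ)
    rw [norm_sub_rev] at this
    linarith [hB θ hθ']
  exact div_le_div₀ hA0 (hA θ hθ') (by linarith) h2

/-- The residue theorem for a simple pole in an annulus. -/
theorem circleIntegral_div_sub_sub_circleIntegral_div_sub {G : ℂ → ℂ} {U : Set ℂ} (hU : IsOpen U)
    {r r' : ℝ} (hr : 0 < r) (hsub : Metric.closedBall 0 r' \ Metric.ball 0 r ⊆ U)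
    (hG : DifferentiableOn ℂ G U) {w₀ : ℂ} (h1 : r < ‖w₀‖) (h2 : ‖w₀‖ < r') :
    (∮ w in C(0, r'), G w / (w - w₀)) - (∮ w in C(0, r), G w / (w - w₀)) =
      2 * Real.pi * Complex.I * G w₀ := by
  have hw₀ : w₀ ∈ U := hsub (by simp [h1.le, h2.le])
  have hds : DifferentiableOn ℂ (dslope G w₀) U :=
    (Complex.differentiableOn_dslope (hU.mem_nhds hw₀)).2 hG
  have hrr' : r ≤ r' := (h1.trans h2).le
  have hsph : ∀ ρ, r ≤ ρ → ρ ≤ r' → Metric.sphere (0 : ℂ) ρ ⊆ U := by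
    intro ρ hρ hρ' w hw
    rw [mem_sphere_zero_iff_norm] at hw
    exact hsub (by simp [hw, hρ, hρ'])
  have hsplit : ∀ ρ, r ≤ ρ → ρ ≤ r' → ρ ≠ ‖w₀‖ → (∮ w in C(0, ρ), G w / (w - w₀)) =
      (∮ w in C(0, ρ), dslope G w₀ w) + G w₀ * ∮ w in C(0, ρ), (w - w₀)⁻¹ := by
    intro ρ hρ hρ' hne
    have hρ0 : 0 ≤ ρ := hr.le.trans hρ
    have hw : ∀ w ∈ Metric.sphere (0 : ℂ) ρ, w - w₀ ≠ 0 := by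
      intro w hw h
      rw [mem_sphere_zero_iff_norm, sub_eq_zero.1 h] at hw
      exact hne hw.symm
    rw [← smul_eq_mul, ← circleIntegral.integral_smul, ← circleIntegral.integral_add]
    · refine circleIntegral.integral_congr hρ0 fun w hw' => ?_
      have h3 := hw w hw'
      simp only [dslope_of_ne _ (sub_ne_zero.1 h3), slope_def_field, smul_eq_mul]
      field_simp
      ring
    · exact (hds.continuousOn.mono (hsph ρ hρ hρ')).circleIntegrable hρ0
    · have h4 : ContinuousOn (fun w => (w - w₀)⁻¹) (Metric.sphere (0 : ℂ) ρ) :=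
        ContinuousOn.inv₀ (by fun_prop) hw
      exact (h4.const_smul (G w₀)).circleIntegrable hρ0
  have hann : (∮ w in C(0, r'), dslope G w₀ w) = ∮ w in C(0, r), dslope G w₀ w := by
    refine Complex.circleIntegral_eq_of_differentiable_on_annulus_off_countable hr hrr'
      countable_empty (hds.continuousOn.mono hsub) fun w hw => ?_
    exact hds.differentiableAt (hU.mem_nhds (hsub ⟨Metric.ball_subset_closedBall hw.1.1,
      fun h => hw.1.2 (Metric.ball_subset_closedBall h)⟩))
  have hout : (∮ w in C(0, r'), (w - w₀)⁻¹) = 2 * Real.pi * Complex.I :=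
    circleIntegral.integral_sub_inv_of_mem_ball (by simpa using h2)
  have hin : (∮ w in C(0, r), (w - w₀)⁻¹) = 0 := by
    have hne : ∀ w ∈ Metric.closedBall (0 : ℂ) r, w - w₀ ≠ 0 := by
      intro w hw h
      rw [mem_closedBall_zero_iff, sub_eq_zero.1 h] at hw
      exact absurd h1 hw.not_gt
    have hd : DifferentiableOn ℂ (fun w => (w - w₀)⁻¹) (Metric.closedBall 0 r) :=
      DifferentiableOn.inv (by fun_prop) hne
    refine Complex.circleIntegral_eq_zero_of_differentiable_on_off_countable hr.le
      countable_empty hd.continuousOn fun w hw => ?_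
    exact hd.differentiableAt (mem_of_superset (Metric.isOpen_ball.mem_nhds hw.1)
      Metric.ball_subset_closedBall)
  rw [hsplit r' hrr' le_rfl h2.ne', hsplit r le_rfl hrr' h1.ne, hann, hout, hin]
  ring

section

variable {K : Set ℂ}

theorem isOpen_annulus (R : ℝ) : IsOpen {w : ℂ | 1 < ‖w‖ ∧ ‖w‖ < R} :=
  isOpen_one_lt_norm.inter (isOpen_lt continuous_norm continuous_const)

theorem differentiableOn_deriv_exteriorInv (hK : IsCompact K)
    (h : IsExteriorMap K (exteriorMap K)) :
    DifferentiableOn ℂ (deriv (exteriorInv K)) {w : ℂ | 1 < ‖w‖} :=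
  (differentiableOn_exteriorInv hK h).deriv isOpen_one_lt_norm

/-- The Cauchy integral of `F` over the level curve of radius `r`, in the coordinate `w = φ ζ`. -/
noncomputable def levelCauchyIntegral (K : Set ℂ) (F : ℂ → ℂ) (r : ℝ) (z : ℂ) : ℂ :=
  ∮ w in C(0, r), F (exteriorInv K w) * deriv (exteriorInv K) w / (exteriorInv K w - z)

theorem continuous_comp_circleMap {f : ℂ → ℂ} {r : ℝ} (hr : 0 ≤ r)
    (hf : ContinuousOn f (Metric.sphere 0 r)) : Continuous fun θ => f (circleMap 0 r θ) :=
  hf.comp_continuous (continuous_circleMap 0 r) fun θ => circleMap_mem_sphere 0 hr θ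

theorem exists_levelCauchyIntegral_eq (hK : IsCompact K) (h : IsExteriorMap K (exteriorMap K))
    {R r : ℝ} (hr : 1 < r) (hrR : r < R) {F : ℂ → ℂ}
    (hF : DifferentiableOn ℂ F (levelInterior K R)) :
    ∃ H : ℝ → ℂ, Continuous H ∧ levelCauchyIntegral K F r = fun z =>
      ∫ θ in 0..2 * Real.pi, H θ / (exteriorInv K (circleMap 0 r θ) - z) := by
  have hr0 : 0 ≤ r := by linarith
  have hsph : Metric.sphere (0 : ℂ) r ⊆ {w | 1 < ‖w‖} := fun w hw => by
    rw [mem_sphere_zero_iff_norm] at hw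
    exact hr.trans_eq hw.symm
  have hFc : ContinuousOn (fun w => F (exteriorInv K w)) (Metric.sphere 0 r) := by
    refine hF.continuousOn.comp ((differentiableOn_exteriorInv hK h).continuousOn.mono hsph) ?_
    intro w hw
    refine exteriorInv_mem_levelInterior h (hsph hw) ?_
    rwa [mem_sphere_zero_iff_norm.1 hw]
  refine ⟨fun θ => circleMap 0 r θ * Complex.I * (F (exteriorInv K (circleMap 0 r θ)) *
    deriv (exteriorInv K) (circleMap 0 r θ)), ?_, ?_⟩
  · refine ((continuous_circleMap 0 r).mul continuous_const).mul
      ((continuous_comp_circleMap hr0 hFc).mul (continuous_comp_circleMap hr0 ?_))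
    exact (differentiableOn_deriv_exteriorInv hK h).continuousOn.mono hsph
  · funext z
    simp only [levelCauchyIntegral, circleIntegral, deriv_circleMap, smul_eq_mul, mul_div_assoc]

theorem continuous_exteriorInv_circleMap (hK : IsCompact K) (h : IsExteriorMap K (exteriorMap K))
    {r : ℝ} (hr : 1 < r) : Continuous fun θ => exteriorInv K (circleMap 0 r θ) := by
  refine continuous_comp_circleMap (by linarith)
    ((differentiableOn_exteriorInv hK h).continuousOn.mono fun w hw => ?_)
  rw [mem_sphere_zero_iff_norm] at hw
  exact hr.trans_eq hw.symm

theorem norm_circleMap_zero_of_pos {r : ℝ} (hr : 0 < r) (θ : ℝ) : ‖circleMap 0 r θ‖ = r := by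
  simp [abs_of_pos hr]

/-- The jump of the Cauchy integral across a point `z = φ⁻¹ w₀`. In the coordinate `w` the integrand
has a simple pole at `w₀` only, since `φ⁻¹` is injective; dividing the difference quotient
`dslope φ⁻¹ w₀` out of the denominator leaves `w - w₀`. -/
theorem levelCauchyIntegral_sub_levelCauchyIntegral (hK : IsCompact K)
    (h : IsExteriorMap K (exteriorMap K)) {R r r' : ℝ} (hr : 1 < r) (hr' : r' < R) {F : ℂ → ℂ}
    (hF : DifferentiableOn ℂ F (levelInterior K R)) {z : ℂ} (hz : z ∉ K)
    (h1 : r < ‖exteriorMap K z‖) (h2 : ‖exteriorMap K z‖ < r') :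
    levelCauchyIntegral K F r' z - levelCauchyIntegral K F r z = 2 * Real.pi * Complex.I * F z := by
  set w₀ := exteriorMap K z with hw₀
  have hzw : exteriorInv K w₀ = z := exteriorInv_exteriorMap h hz
  have hw₀1 : 1 < ‖w₀‖ := hr.trans h1
  set ψ := exteriorInv K with hψ
  have hψd : DifferentiableOn ℂ ψ {w | 1 < ‖w‖} := differentiableOn_exteriorInv hK h
  have hsd : DifferentiableOn ℂ (dslope ψ w₀) {w | 1 < ‖w‖} :=
    (Complex.differentiableOn_dslope (isOpen_one_lt_norm.mem_nhds hw₀1)).2 hψd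
  have hs0 : ∀ w : ℂ, 1 < ‖w‖ → dslope ψ w₀ w ≠ 0 := by
    intro w hw h0
    by_cases hww : w = w₀
    · rw [hww, dslope_same] at h0
      exact deriv_ne_zero_of_injOn isOpen_one_lt_norm hψd (injOn_exteriorInv h) hw₀1 h0
    · rw [dslope_of_ne _ hww, slope_def_field, div_eq_zero_iff] at h0
      rcases h0 with h0 | h0
      · exact hww (injOn_exteriorInv h hw hw₀1 (sub_eq_zero.1 h0))
      · exact hww (sub_eq_zero.1 h0)
  have hFψ : DifferentiableOn ℂ (fun w => F (ψ w)) {w | 1 < ‖w‖ ∧ ‖w‖ < R} :=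
    hF.comp (hψd.mono fun w hw => hw.1) fun w hw => exteriorInv_mem_levelInterior h hw.1 hw.2
  have hG : DifferentiableOn ℂ (fun w => F (ψ w) * deriv ψ w / dslope ψ w₀ w)
      {w | 1 < ‖w‖ ∧ ‖w‖ < R} :=
    (hFψ.mul ((differentiableOn_deriv_exteriorInv hK h).mono fun w hw => hw.1)).div
      (hsd.mono fun w hw => hw.1) fun w hw => hs0 w hw.1
  have key := circleIntegral_div_sub_sub_circleIntegral_div_sub (isOpen_annulus R)
    (one_pos.trans hr) (r' := r') (fun w hw => by
      rw [Set.mem_sdiff, mem_closedBall_zero_iff, mem_ball_zero_iff, not_lt] at hw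
      exact ⟨hr.trans_le hw.2, hw.1.trans_lt hr'⟩) hG h1 h2
  have hcongr : ∀ ρ, 1 < ρ → ρ ≠ ‖w₀‖ → levelCauchyIntegral K F ρ z =
      ∮ w in C(0, ρ), F (ψ w) * deriv ψ w / dslope ψ w₀ w / (w - w₀) := by
    intro ρ hρ hne
    refine circleIntegral.integral_congr (by linarith) fun w hw => ?_
    rw [mem_sphere_zero_iff_norm] at hw
    have hww : w ≠ w₀ := fun h => hne (by rw [← h, hw])
    simp only [dslope_of_ne _ hww, slope_def_field, ← hψ, hzw]
    rw [div_div, div_mul_cancel₀ _ (sub_ne_zero.2 hww)]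
  rw [hcongr r' (hr.trans (h1.trans h2)) h2.ne', hcongr r hr h1.ne, key, dslope_same, hzw,
    mul_div_cancel_right₀]
  exact deriv_ne_zero_of_injOn isOpen_one_lt_norm hψd (injOn_exteriorInv h) hw₀1

/-- **Cauchy's formula** over the level curve of radius `r`. The function equal to the Cauchy
integral minus `F` inside the curve extends, by the residue theorem, to an entire function whose
values outside are Cauchy integrals over a smaller level curve; it vanishes at `∞`. -/
theorem levelCauchyIntegral_eq (hK : IsCompact K) (h : IsExteriorMap K (exteriorMap K))
    {R r : ℝ} (hr : 1 < r) (hrR : r < R) {F : ℂ → ℂ}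
    (hF : DifferentiableOn ℂ F (levelInterior K R)) {z : ℂ} (hz : z ∈ levelInterior K r) :
    levelCauchyIntegral K F r z = 2 * Real.pi * Complex.I * F z := by
  classical
  obtain ⟨s, hs, hsr⟩ := exists_between hr
  have hr0 : 0 < r := by linarith
  have hs0 : 0 < s := by linarith
  have hψn : ∀ ρ, 1 < ρ → ∀ θ, 1 < ‖circleMap 0 ρ θ‖ := fun ρ hρ θ => by
    rwa [norm_circleMap_zero_of_pos (by linarith)]
  set V : Set ℂ := {z | z ∉ K ∧ s < ‖exteriorMap K z‖} with hV
  have hVo : IsOpen V := isOpen_setOf_lt_exteriorMap hK h s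
  have hIo := isOpen_levelInterior hK h hr
  have hin : DifferentiableOn ℂ (levelCauchyIntegral K F r) (levelInterior K r) := by
    obtain ⟨H, hH, he⟩ := exists_levelCauchyIntegral_eq hK h hr hrR hF
    rw [he]
    refine differentiableOn_integral_div_sub hH (continuous_exteriorInv_circleMap hK h hr) hIo
      (fun θ hθ => ?_) _ _
    have := hθ (exteriorInv_notMem h (hψn r hr θ))
    rw [exteriorMap_exteriorInv h (hψn r hr θ), norm_circleMap_zero_of_pos hr0] at this
    exact lt_irrefl _ this
  have hout : DifferentiableOn ℂ (levelCauchyIntegral K F s) V ∧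
      Tendsto (levelCauchyIntegral K F s) (Bornology.cobounded ℂ) (𝓝 0) := by
    obtain ⟨H, hH, he⟩ := exists_levelCauchyIntegral_eq hK h hs (hsr.trans hrR) hF
    rw [he]
    refine ⟨differentiableOn_integral_div_sub hH (continuous_exteriorInv_circleMap hK h hs) hVo
      (fun θ hθ => ?_) _ _, tendsto_integral_div_sub_cobounded hH
        (continuous_exteriorInv_circleMap hK h hs) _ _⟩
    have := hθ.2
    rw [exteriorMap_exteriorInv h (hψn s hs θ), norm_circleMap_zero_of_pos hs0] at this
    exact lt_irrefl _ this
  set E : ℂ → ℂ := fun z => if z ∈ levelInterior K r then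
    levelCauchyIntegral K F r z - 2 * Real.pi * Complex.I * F z else levelCauchyIntegral K F s z
    with hE
  have hEin : ∀ z ∈ levelInterior K r,
      E z = levelCauchyIntegral K F r z - 2 * Real.pi * Complex.I * F z := fun z hz => if_pos hz
  have hEout : ∀ z ∈ V, E z = levelCauchyIntegral K F s z := by
    intro z hzV
    by_cases hzi : z ∈ levelInterior K r
    · rw [hEin z hzi, ← levelCauchyIntegral_sub_levelCauchyIntegral hK h hs hrR hF hzV.1 hzV.2
        (hzi hzV.1)]
      ring
    · exact if_neg hzi
  have hsubR : levelInterior K r ⊆ levelInterior K R := fun y hy hyK => (hy hyK).trans hrR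
  have hEd : Differentiable ℂ E := by
    intro z
    by_cases hzi : z ∈ levelInterior K r
    · refine ((hin.sub ((hF.mono hsubR).const_mul (2 * Real.pi * Complex.I))).differentiableAt
        (hIo.mem_nhds hzi)).congr_of_eventuallyEq ?_
      filter_upwards [hIo.mem_nhds hzi] with y hy using hEin y hy
    · have hzV : z ∈ V := by
        simp only [levelInterior, mem_ofPred_eq, Classical.not_imp, not_lt] at hzi
        exact ⟨hzi.1, hsr.trans_le hzi.2⟩
      refine (hout.1.differentiableAt (hVo.mem_nhds hzV)).congr_of_eventuallyEq ?_
      filter_upwards [hVo.mem_nhds hzV] with y hy using hEout y hy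
  have hElim : Tendsto E (cocompact ℂ) (𝓝 0) := by
    rw [← Metric.cobounded_eq_cocompact]
    refine hout.2.congr' ?_
    filter_upwards [Bornology.isBounded_def.1 (isBounded_levelInterior hK h r)] with y hy
    exact (if_neg hy).symm
  have := hEd.apply_eq_of_tendsto_cocompact z hElim
  rw [hEin z hz] at this
  exact sub_eq_zero.1 this

/-- The Cauchy kernel of the level curves, with respect to the normalized arc measure
`|dw| / (2 π |w|)` in the coordinate `w = φ ζ`. -/
noncomputable def levelKernel (K : Set ℂ) (z w : ℂ) : ℂ :=
  w * deriv (exteriorInv K) w / (exteriorInv K w - z)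

theorem circleAverage_mul_levelKernel (hK : IsCompact K) (h : IsExteriorMap K (exteriorMap K))
    {R r : ℝ} (hr : 1 < r) (hrR : r < R) {F : ℂ → ℂ}
    (hF : DifferentiableOn ℂ F (levelInterior K R)) {z : ℂ} (hz : z ∈ K) :
    Real.circleAverage (fun w => F (exteriorInv K w) * levelKernel K z w) 0 r = F z := by
  have hr0 : 0 < r := by linarith
  have h1 := levelCauchyIntegral_eq hK h hr hrR hF (subset_levelInterior r hz)
  rw [Real.circleAverage_eq_circleIntegral hr0.ne', inv_smul_eq_iff₀ Complex.two_pi_I_ne_zero,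
    smul_eq_mul, ← h1]
  refine circleIntegral.integral_congr hr0.le fun w hw => ?_
  have hw0 : w ≠ 0 := by
    rintro rfl
    rw [mem_sphere_zero_iff_norm, norm_zero] at hw
    exact hr0.ne hw
  simp only [levelKernel, sub_zero, smul_eq_mul]
  field_simp

end

/-! ### The length of a level curve -/

/-- The arc length integral of a `C¹` curve is at most its total variation. -/
theorem integral_norm_deriv_le_eVariationOn {γ γ' : ℝ → ℂ} (hγ : ∀ t, HasDerivAt γ (γ' t) t)
    (hγ' : Continuous γ') {a b : ℝ} (hab : a ≤ b) :
    ∫ t in a..b, ‖γ' t‖ ≤ (eVariationOn γ (Icc a b)).toReal := by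
  have hbv : eVariationOn γ (Icc a b) ≠ ⊤ := by
    have hc : ContDiff ℝ 1 γ := by
      rw [contDiff_one_iff_deriv]
      refine ⟨fun t => (hγ t).differentiableAt, ?_⟩
      rwa [show deriv γ = γ' from funext fun t => (hγ t).deriv]
    have := (hc.contDiffOn (s := uIcc a b)).absolutelyContinuousOnInterval.boundedVariationOn
    rwa [uIcc_of_le hab] at this
  refine le_of_forall_pos_le_add fun ε hε => ?_
  -- on intervals of length less than `δ`, `γ'` varies by at most `η`
  set η : ℝ := ε / (2 * (b - a + 1)) with hη
  have hba : 0 < b - a + 1 := by linarith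
  have hη0 : 0 < η := by positivity
  obtain ⟨δ, hδ, hunif⟩ := Metric.uniformContinuousOn_iff.1
    ((isCompact_Icc (a := a) (b := b)).uniformContinuousOn_of_continuous hγ'.continuousOn) η hη0
  obtain ⟨n, hn⟩ := exists_nat_gt ((b - a) / δ)
  have hn0 : (0 : ℝ) < n := (div_nonneg (by linarith) hδ.le).trans_lt hn
  set u : ℕ → ℝ := fun i => a + i * ((b - a) / n) with hu
  have hstep : 0 ≤ (b - a) / n := div_nonneg (by linarith) hn0.le
  have hstepδ : (b - a) / n < δ := by
    rw [div_lt_iff₀ hn0]; rw [div_lt_iff₀ hδ] at hn; linarith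
  have humono : Monotone u := fun i j hij => by
    simp only [hu]
    have : (i : ℝ) ≤ j := by exact_mod_cast hij
    gcongr
  have hu0 : u 0 = a := by simp [hu]
  have hun : u n = b := by simp only [hu]; field_simp; ring
  have huIcc : ∀ i ≤ n, u i ∈ Icc a b := fun i hi =>
    ⟨hu0 ▸ humono (Nat.zero_le i), hun ▸ humono hi⟩
  have hsucc : ∀ i, u (i + 1) - u i = (b - a) / n := fun i => by
    simp only [hu]; push_cast; ring
  have hpiece : ∀ i < n, ∫ t in u i..u (i + 1), ‖γ' t‖ ≤
      ‖γ (u (i + 1)) - γ (u i)‖ + 2 * η * ((b - a) / n) := by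
    intro i hi
    have hle : u i ≤ u (i + 1) := humono (Nat.le_succ i)
    have hclose : ∀ t ∈ Icc (u i) (u (i + 1)), ‖γ' t - γ' (u i)‖ ≤ η := by
      intro t ht
      rw [← dist_eq_norm]
      refine (hunif t ⟨(huIcc i hi.le).1.trans ht.1, ht.2.trans (huIcc (i + 1) hi).2⟩ (u i)
        (huIcc i hi.le) ?_).le
      rw [Real.dist_eq, abs_of_nonneg (by linarith [ht.1])]
      linarith [ht.2, hsucc i]
    have h1 : ∫ t in u i..u (i + 1), ‖γ' t‖ ≤ ∫ _ in u i..u (i + 1), (‖γ' (u i)‖ + η) := by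
      refine intervalIntegral.integral_mono_on hle (hγ'.norm.intervalIntegrable _ _)
        intervalIntegrable_const fun t ht => ?_
      linarith [norm_sub_norm_le (γ' t) (γ' (u i)), hclose t ht]
    rw [intervalIntegral.integral_const, hsucc, smul_eq_mul] at h1
    have h2 := (convex_Icc (u i) (u (i + 1))).norm_image_sub_le_of_norm_hasDerivWithin_le
      (f := fun t => γ t - t • γ' (u i)) (f' := fun t => γ' t - (1 : ℝ) • γ' (u i)) (C := η)
      (fun t _ => ((hγ t).sub ((hasDerivAt_id t).smul_const _)).hasDerivWithinAt)
      (fun t ht => by simpa using hclose t ht) (left_mem_Icc.2 hle) (right_mem_Icc.2 hle)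
    have h3 : γ (u (i + 1)) - u (i + 1) • γ' (u i) - (γ (u i) - u i • γ' (u i)) =
        (γ (u (i + 1)) - γ (u i)) - ((b - a) / n) • γ' (u i) := by
      rw [← hsucc i, sub_smul]; ring
    rw [h3, hsucc, Real.norm_of_nonneg hstep] at h2
    have h4 := norm_sub_norm_le (((b - a) / n) • γ' (u i)) (γ (u (i + 1)) - γ (u i))
    rw [norm_sub_rev (((b - a) / n) • γ' (u i)), norm_smul, Real.norm_of_nonneg hstep] at h4
    rw [mul_add] at h1
    linarith
  have hsum : ∫ t in a..b, ‖γ' t‖ = ∑ i ∈ Finset.range n, ∫ t in u i..u (i + 1), ‖γ' t‖ := by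
    rw [intervalIntegral.sum_integral_adjacent_intervals
      (fun k _ => hγ'.norm.intervalIntegrable _ _), hu0, hun]
  have hvar : ∑ i ∈ Finset.range n, ‖γ (u (i + 1)) - γ (u i)‖ ≤
      (eVariationOn γ (Icc a b)).toReal := by
    have h1 := eVariationOn.sum_le_of_monotoneOn_Icc (f := γ) (s := Icc a b) (m := 0) (n := n)
      (humono.monotoneOn _) fun i hi => huIcc i hi.2
    rw [← Finset.range_eq_Ico] at h1
    have h2 := ENNReal.toReal_mono hbv h1
    rw [ENNReal.toReal_sum fun i _ => edist_ne_top _ _] at h2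
    simpa [edist_dist, dist_eq_norm] using h2
  calc ∫ t in a..b, ‖γ' t‖ = ∑ i ∈ Finset.range n, ∫ t in u i..u (i + 1), ‖γ' t‖ := hsum
    _ ≤ ∑ i ∈ Finset.range n, (‖γ (u (i + 1)) - γ (u i)‖ + 2 * η * ((b - a) / n)) :=
        Finset.sum_le_sum fun i hi => hpiece i (Finset.mem_range.1 hi)
    _ = ∑ i ∈ Finset.range n, ‖γ (u (i + 1)) - γ (u i)‖ + 2 * η * (b - a) := by
        rw [Finset.sum_add_distrib, Finset.sum_const, Finset.card_range, nsmul_eq_mul]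
        field_simp
    _ ≤ _ := by
        have : 2 * η * (b - a) ≤ ε := by
          rw [hη]
          have : 2 * (ε / (2 * (b - a + 1))) * (b - a) = ε * ((b - a) / (b - a + 1)) := by
            field_simp
          rw [this]
          refine mul_le_of_le_one_right hε.le ?_
          rw [div_le_one hba]; linarith
        linarith

/-- The `L¹` norm of the Cauchy kernel over a level curve is at most `ℓ / d`; the factor `1 / 2π`
is dropped. -/
theorem circleAverage_norm_levelKernel_le {K : Set ℂ} (hK : IsCompact K)
    (h : IsExteriorMap K (exteriorMap K)) {r : ℝ} (hr : 1 < r) {z : ℂ} (hz : z ∈ K) :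
    Real.circleAverage (fun w => ‖levelKernel K z w‖) 0 r ≤
      levelCurveLength K r / setDist K (levelCurve K r) := by
  have hr0 : 0 < r := by linarith
  set d := setDist K (levelCurve K r) with hd
  have hd0 : 0 < d := setDist_levelCurve_pos hK ⟨z, hz⟩ h hr
  have hn : ∀ θ, 1 < ‖circleMap 0 r θ‖ := fun θ => by rwa [norm_circleMap_zero_of_pos hr0]
  set γ : ℝ → ℂ := fun θ => exteriorInv K (circleMap 0 r θ) with hγ
  set γ' : ℝ → ℂ := fun θ => deriv (exteriorInv K) (circleMap 0 r θ) * (circleMap 0 r θ * Complex.I)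
    with hγ'
  have hder : ∀ θ, HasDerivAt γ (γ' θ) θ := by
    intro θ
    exact ((differentiableOn_exteriorInv hK h).differentiableAt
      (isOpen_one_lt_norm.mem_nhds (hn θ))).hasDerivAt.comp θ (hasDerivAt_circleMap 0 r θ)
  have hc' : Continuous γ' := by
    refine (continuous_comp_circleMap hr0.le
      ((differentiableOn_deriv_exteriorInv hK h).continuousOn.mono fun w hw => ?_)).mul
      ((continuous_circleMap 0 r).mul continuous_const)
    rw [mem_sphere_zero_iff_norm] at hw
    exact hr.trans_eq hw.symm
  have hlen : ∫ θ in 0..2 * Real.pi, ‖γ' θ‖ ≤ levelCurveLength K r := by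
    have h1 := integral_norm_deriv_le_eVariationOn hder hc' Real.two_pi_pos.le
    rw [levelCurveLength]
    simpa only [hγ, circleMap, zero_add] using h1
  have hfar : ∀ θ, d ≤ ‖γ θ - z‖ := by
    intro θ
    rw [norm_sub_rev]
    refine setDist_le hz ?_
    rw [levelCurve_eq_image h hr]
    exact mem_image_of_mem _ (circleMap_mem_sphere 0 hr0.le θ)
  have hne : ∀ θ, γ θ - z ≠ 0 := fun θ => norm_pos_iff.1 (hd0.trans_le (hfar θ))
  have hcγ : Continuous γ := continuous_exteriorInv_circleMap hK h hr
  have hk : ∀ θ, ‖levelKernel K z (circleMap 0 r θ)‖ = ‖γ' θ‖ / ‖γ θ - z‖ := by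
    intro θ
    simp only [levelKernel, hγ, hγ', norm_div, norm_mul, Complex.norm_I, mul_one]
    rw [mul_comm]
  have hint : ∫ θ in 0..2 * Real.pi, ‖γ' θ‖ / ‖γ θ - z‖ ≤ levelCurveLength K r / d := by
    calc ∫ θ in 0..2 * Real.pi, ‖γ' θ‖ / ‖γ θ - z‖ ≤ ∫ θ in 0..2 * Real.pi, ‖γ' θ‖ / d := by
          refine intervalIntegral.integral_mono_on Real.two_pi_pos.le
            ((hc'.norm.div (hcγ.sub continuous_const).norm
              fun θ => norm_ne_zero_iff.2 (hne θ)).intervalIntegrable _ _)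
            ((hc'.norm.div_const d).intervalIntegrable _ _) fun θ _ => ?_
          exact div_le_div_of_nonneg_left (norm_nonneg _) hd0 (hfar θ)
      _ = (∫ θ in 0..2 * Real.pi, ‖γ' θ‖) / d := intervalIntegral.integral_div _ _
      _ ≤ levelCurveLength K r / d := by gcongr
  rw [Real.circleAverage_def]
  simp only [hk, smul_eq_mul]
  refine (mul_le_of_le_one_left ?_ ?_).trans hint
  · exact intervalIntegral.integral_nonneg Real.two_pi_pos.le fun θ _ => by positivity
  · exact inv_le_one_of_one_le₀ (by linarith [Real.pi_gt_three])

/-! ### Faber polynomials -/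

/-- `φ⁻¹` in the coordinate `u = 1 / w` at `∞`: the function `u φ⁻¹(1 / u)` is holomorphic in the
unit disc and does not vanish at `0`. -/
theorem exists_differentiableOn_mul_exteriorInv_inv {K : Set ℂ} (hK : IsCompact K)
    (h : IsExteriorMap K (exteriorMap K)) :
    ∃ g : ℂ → ℂ, DifferentiableOn ℂ g (Metric.ball 0 1) ∧ g 0 ≠ 0 ∧
      ∀ u, u ≠ 0 → g u = u * exteriorInv K u⁻¹ := by
  obtain ⟨b, hb, hlim⟩ := exists_tendsto_exteriorInv_div hK h
  set g : ℂ → ℂ := Function.update (fun u => u * exteriorInv K u⁻¹) 0 b with hg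
  have hgu : ∀ u, u ≠ 0 → g u = u * exteriorInv K u⁻¹ := fun u hu => Function.update_of_ne hu _ _
  have hg0 : g 0 = b := Function.update_self _ _ _
  refine ⟨g, ?_, hg0 ▸ hb, hgu⟩
  refine (Complex.differentiableOn_compl_singleton_and_continuousAt_iff
    (Metric.ball_mem_nhds 0 one_pos)).1 ⟨?_, ?_⟩
  · have h1 : DifferentiableOn ℂ (fun u => u * exteriorInv K u⁻¹) (Metric.ball 0 1 \ {0}) := by
      refine differentiableOn_id.mul ((differentiableOn_exteriorInv hK h).comp
        (DifferentiableOn.inv differentiableOn_id fun u hu => hu.2) fun u hu => ?_)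
      have hu0 : u ≠ 0 := hu.2
      rw [mem_ofPred_eq, norm_inv, one_lt_inv_iff₀]
      exact ⟨norm_pos_iff.2 hu0, mem_ball_zero_iff.1 hu.1⟩
    exact h1.congr fun u hu => hgu u hu.2
  · rw [continuousAt_iff_punctured_nhds, hg0]
    refine (hlim.comp tendsto_inv₀_nhdsNE_zero).congr' ?_
    filter_upwards [self_mem_nhdsWithin] with u hu
    rw [hgu u hu]
    simp only [Function.comp_apply, div_inv_eq_mul, mul_comm]

/-- The Taylor coefficients at `0` of a quotient `N(u) / (g(u) - z u)` are polynomials in `z`, the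
`n`-th one of degree at most `n`: they are determined recursively by Leibniz' rule. -/
theorem exists_polynomial_iteratedDeriv_div {N g : ℂ → ℂ} (hN : AnalyticAt ℂ N 0)
    (hg : AnalyticAt ℂ g 0) (hg0 : g 0 ≠ 0) (n : ℕ) :
    ∃ p : Polynomial ℂ, p.natDegree ≤ n ∧
      ∀ z, iteratedDeriv n (fun u => N u / (g u - z * u)) 0 = p.eval z := by
  have hD : ∀ z, AnalyticAt ℂ (fun u => g u - z * u) 0 := fun z =>
    hg.sub (analyticAt_const.mul analyticAt_id)
  have hk : ∀ z, AnalyticAt ℂ (fun u => N u / (g u - z * u)) 0 := fun z =>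
    hN.div (hD z) (by simpa using hg0)
  have hDz : ∀ z j, iteratedDeriv j (fun u => g u - z * u) 0 =
      iteratedDeriv j g 0 - z * iteratedDeriv j id 0 := by
    intro z j
    have h1 : ContDiffAt ℂ j (fun u : ℂ => z * u) 0 := by fun_prop
    rw [iteratedDeriv_fun_sub hg.contDiffAt h1]
    congr 1
    exact iteratedDeriv_const_mul_field z id
  have hrec : ∀ z n, iteratedDeriv n (fun u => N u / (g u - z * u)) 0 = (g 0)⁻¹ *
      (iteratedDeriv n N 0 - ∑ i ∈ Finset.range n, (n.choose i : ℂ) *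
        iteratedDeriv i (fun u => N u / (g u - z * u)) 0 *
        (iteratedDeriv (n - i) g 0 - z * iteratedDeriv (n - i) id 0)) := by
    intro z n
    have h1 : N =ᶠ[𝓝 0] fun u => N u / (g u - z * u) * (g u - z * u) := by
      filter_upwards [(hD z).continuousAt.eventually_ne (by simpa using hg0)] with u hu
      rw [div_mul_cancel₀ _ hu]
    have h2 := h1.iteratedDeriv_eq n
    rw [iteratedDeriv_fun_mul (hk z).contDiffAt (hD z).contDiffAt, Finset.sum_range_succ] at h2
    rw [h2]
    simp only [hDz, Nat.sub_self, iteratedDeriv_zero, Nat.choose_self, id, mul_zero, sub_zero,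
      Nat.cast_one, one_mul]
    field_simp
    ring
  induction n using Nat.strong_induction_on with
  | _ n ih =>
    choose! p hp1 hp2 using ih
    refine ⟨Polynomial.C (g 0)⁻¹ * (Polynomial.C (iteratedDeriv n N 0) -
      ∑ i ∈ Finset.range n, Polynomial.C (n.choose i : ℂ) * p i *
        (Polynomial.C (iteratedDeriv (n - i) g 0) -
          Polynomial.X * Polynomial.C (iteratedDeriv (n - i) id 0))), ?_, fun z => ?_⟩
    · refine (Polynomial.natDegree_C_mul_le _ _).trans ?_
      refine (Polynomial.natDegree_sub_le _ _).trans (max_le (by simp) ?_)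
      refine Polynomial.natDegree_sum_le_of_forall_le _ _ fun i hi => ?_
      have hin := Finset.mem_range.1 hi
      have e1 : (Polynomial.C (n.choose i : ℂ) * p i).natDegree ≤ i :=
        (Polynomial.natDegree_C_mul_le _ _).trans (hp1 i hin)
      have e2 : (Polynomial.C (iteratedDeriv (n - i) g 0) -
          Polynomial.X * Polynomial.C (iteratedDeriv (n - i) id (0 : ℂ))).natDegree ≤ 1 := by
        refine (Polynomial.natDegree_sub_le _ _).trans (max_le (by simp) ?_)
        exact (Polynomial.natDegree_mul_C_le _ _).trans Polynomial.natDegree_X_le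
      exact (Polynomial.natDegree_mul_le).trans (by omega)
    · rw [hrec z n]
      simp only [Polynomial.eval_mul, Polynomial.eval_C, Polynomial.eval_sub,
        Polynomial.eval_finsetSum, Polynomial.eval_X]
      congr 2
      refine Finset.sum_congr rfl fun i hi => ?_
      rw [hp2 i (Finset.mem_range.1 hi)]

/-- The **Faber polynomials** of `K` are the coefficients of the expansion of the Cauchy kernel at
`∞`, in powers of `u = 1 / w`. -/
theorem exists_faberPolynomials {K : Set ℂ} (hK : IsCompact K)
    (h : IsExteriorMap K (exteriorMap K)) :
    ∃ F : ℕ → Polynomial ℂ, (∀ n, (F n).natDegree ≤ n) ∧ ∀ z ∈ K, ∀ u : ℂ, u ≠ 0 → ‖u‖ < 1 →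
      HasSum (fun n => (F n).eval z * u ^ n) (levelKernel K z u⁻¹) := by
  obtain ⟨g, hgd, hg0, hgu⟩ := exists_differentiableOn_mul_exteriorInv_inv hK h
  have hball : Metric.ball (0 : ℂ) 1 ∈ 𝓝 0 := Metric.ball_mem_nhds 0 one_pos
  have hg'd : DifferentiableOn ℂ (deriv g) (Metric.ball 0 1) := hgd.deriv Metric.isOpen_ball
  have hNd : DifferentiableOn ℂ (fun u => g u - u * deriv g u) (Metric.ball 0 1) :=
    hgd.sub (differentiableOn_id.mul hg'd)
  choose p hp1 hp2 using exists_polynomial_iteratedDeriv_div (hNd.analyticAt hball)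
    (hgd.analyticAt hball) hg0
  have hden : ∀ z ∈ K, ∀ u ∈ Metric.ball (0 : ℂ) 1, g u - z * u ≠ 0 := by
    intro z hz u hu h0
    by_cases hu0 : u = 0
    · rw [hu0] at h0
      exact hg0 (by simpa using h0)
    · rw [hgu u hu0] at h0
      have h1 : u * (exteriorInv K u⁻¹ - z) = 0 := by linear_combination h0
      have h2 := (mul_eq_zero.1 h1).resolve_left hu0
      have hu1 : 1 < ‖u⁻¹‖ := by
        rw [norm_inv, one_lt_inv_iff₀]
        exact ⟨norm_pos_iff.2 hu0, mem_ball_zero_iff.1 hu⟩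
      exact exteriorInv_notMem h hu1 (by rwa [sub_eq_zero.1 h2])
  refine ⟨fun n => Polynomial.C (n.factorial : ℂ)⁻¹ * p n, fun n =>
    (Polynomial.natDegree_C_mul_le _ _).trans (hp1 n), fun z hz u hu0 hu => ?_⟩
  have hub : u ∈ Metric.ball (0 : ℂ) 1 := mem_ball_zero_iff.2 hu
  have hkd : DifferentiableOn ℂ (fun u => (g u - u * deriv g u) / (g u - z * u))
      (Metric.ball 0 1) :=
    hNd.div (hgd.sub ((differentiableOn_const z).mul differentiableOn_id)) (hden z hz)
  have hval : levelKernel K z u⁻¹ = (g u - u * deriv g u) / (g u - z * u) := by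
    have hu1 : 1 < ‖u⁻¹‖ := by
      rw [norm_inv, one_lt_inv_iff₀]
      exact ⟨norm_pos_iff.2 hu0, hu⟩
    have hψ : HasDerivAt (exteriorInv K) (g u - u * deriv g u) u⁻¹ := by
      have h1 : HasDerivAt (fun w => w * g w⁻¹)
          (1 * g (u⁻¹)⁻¹ + u⁻¹ * (deriv g u * (-((u⁻¹) ^ 2)⁻¹))) u⁻¹ := by
        refine (hasDerivAt_id u⁻¹).mul (HasDerivAt.comp (h := fun w : ℂ => w⁻¹) u⁻¹ ?_
          (hasDerivAt_inv (inv_ne_zero hu0)))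
        rw [inv_inv]
        exact (hgd.differentiableAt (Metric.isOpen_ball.mem_nhds hub)).hasDerivAt
      have h2 : 1 * g (u⁻¹)⁻¹ + u⁻¹ * (deriv g u * (-((u⁻¹) ^ 2)⁻¹)) = g u - u * deriv g u := by
        rw [inv_inv]
        field_simp
        ring
      rw [h2] at h1
      refine h1.congr_of_eventuallyEq ?_
      filter_upwards [eventually_ne_nhds (inv_ne_zero hu0)] with w hw
      rw [hgu w⁻¹ (inv_ne_zero hw), inv_inv]
      field_simp
    have hd := hden z hz u hub
    rw [levelKernel, hψ.deriv]
    rw [hgu u hu0] at hd ⊢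
    have hd' : exteriorInv K u⁻¹ - z ≠ 0 := fun h0 => hd (by linear_combination u * h0)
    field_simp
  rw [hval]
  refine (Complex.hasSum_taylorSeries_on_ball hkd hub).congr_fun fun n => ?_
  rw [hp2, Polynomial.eval_mul, Polynomial.eval_C, sub_zero, smul_eq_mul, smul_eq_mul]
  ring

/-! ### Integration over circles and tori -/

section Torus

open MeasureTheory

/-- The uniform probability measure on the parameter interval `(0, 2π]` of a circle. -/
noncomputable def arcMeasure : Measure ℝ :=
  ENNReal.ofReal (2 * Real.pi)⁻¹ • volume.restrict (Ioc 0 (2 * Real.pi))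

theorem integral_arcMeasure {E : Type*} [NormedAddCommGroup E] [NormedSpace ℝ E] (g : ℝ → E) :
    ∫ θ, g θ ∂arcMeasure = (2 * Real.pi)⁻¹ • ∫ θ in 0..2 * Real.pi, g θ := by
  rw [arcMeasure, integral_smul_measure, intervalIntegral.integral_of_le Real.two_pi_pos.le,
    ENNReal.toReal_ofReal (inv_nonneg.2 Real.two_pi_pos.le)]

theorem integral_arcMeasure_circleMap {E : Type*} [NormedAddCommGroup E] [NormedSpace ℝ E]
    (g : ℂ → E) (r : ℝ) :
    ∫ θ, g (circleMap 0 r θ) ∂arcMeasure = Real.circleAverage g 0 r := by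
  rw [integral_arcMeasure, Real.circleAverage_def]

/-- Rotation invariance of the average over a circle. -/
theorem integral_arcMeasure_mul_circleMap {E : Type*} [NormedAddCommGroup E] [NormedSpace ℝ E]
    (g : ℂ → E) (c : ℂ) (r : ℝ) :
    ∫ θ, g (c * circleMap 0 r θ) ∂arcMeasure = Real.circleAverage g 0 (‖c‖ * r) := by
  rw [integral_arcMeasure, Real.circleAverage_eq_integral_add c.arg]
  congr 2
  funext θ
  congr 1
  conv_lhs => rw [← Complex.norm_mul_exp_arg_mul_I c]
  simp only [circleMap, zero_add, Complex.ofReal_add, add_mul, Complex.exp_add, Complex.ofReal_mul]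
  ring

instance : IsProbabilityMeasure arcMeasure := by
  refine ⟨?_⟩
  rw [arcMeasure, Measure.smul_apply, Measure.restrict_apply_univ, Real.volume_Ioc, sub_zero,
    smul_eq_mul, ← ENNReal.ofReal_mul (inv_nonneg.2 Real.two_pi_pos.le),
    inv_mul_cancel₀ Real.two_pi_pos.ne', ENNReal.ofReal_one]

theorem arcMeasure_restrict : arcMeasure.restrict (Icc 0 (2 * Real.pi)) = arcMeasure := by
  rw [arcMeasure, Measure.restrict_smul, Measure.restrict_restrict measurableSet_Icc,
    inter_eq_right.2 Ioc_subset_Icc_self]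

theorem integrable_pi_arcMeasure {E : Type*} [NormedAddCommGroup E] {n : ℕ}
    {g : (Fin n → ℝ) → E} (hg : Continuous g) :
    Integrable g (Measure.pi fun _ => arcMeasure) := by
  have h1 : (Measure.pi fun _ : Fin n => arcMeasure).restrict
      (univ.pi fun _ => Icc 0 (2 * Real.pi)) = Measure.pi fun _ => arcMeasure := by
    rw [Measure.restrict_pi_pi]
    simp only [arcMeasure_restrict]
  rw [← h1]
  exact hg.continuousOn.integrableOn_compact (isCompact_univ_pi fun _ => isCompact_Icc)

theorem integrable_arcMeasure {E : Type*} [NormedAddCommGroup E]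
    {g : ℝ → E} (hg : Continuous g) : Integrable g arcMeasure := by
  rw [← arcMeasure_restrict]
  exact hg.continuousOn.integrableOn_compact isCompact_Icc

/-- Integral formulas in each variable separately combine to an integral formula over the torus. -/
theorem integral_pi_mul_prod_eq {n : ℕ} {D : Fin n → Set ℂ} {γ κ : Fin n → ℝ → ℂ}
    (hγ : ∀ i, Continuous (γ i)) (hγD : ∀ i θ, γ i θ ∈ D i) (hκ : ∀ i, Continuous (κ i))
    {z : Fin n → ℂ} (hz : ∀ i, z i ∈ D i) {f : (Fin n → ℂ) → ℂ}
    (hf : ContinuousOn f (univ.pi D))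
    (hrep : ∀ i, ∀ y ∈ univ.pi D,
      ∫ θ, f (Function.update y i (γ i θ)) * κ i θ ∂arcMeasure = f (Function.update y i (z i))) :
    ∫ θ, f (fun i => γ i (θ i)) * ∏ i, κ i (θ i) ∂(Measure.pi fun _ => arcMeasure) = f z := by
  induction n with
  | zero =>
    rw [Measure.pi_of_empty _ (0 : Fin 0 → ℝ), integral_dirac]
    simp only [Finset.univ_eq_empty, Finset.prod_empty, mul_one]
    congr 1
    exact Subsingleton.elim _ _
  | succ n ih =>
    have hcons : ∀ a ∈ D 0, ∀ y ∈ univ.pi (fun i : Fin n => D i.succ),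
        (Fin.cons a y : Fin (n + 1) → ℂ) ∈ univ.pi D := by
      intro a ha y hy i _
      refine Fin.cases ?_ (fun i => ?_) i
      · simpa using ha
      · simpa using hy i trivial
    have hcont : Continuous fun θ : Fin (n + 1) → ℝ =>
        f (fun i => γ i (θ i)) * ∏ i, κ i (θ i) := by
      refine Continuous.mul (hf.comp_continuous (by fun_prop) fun θ i _ => hγD i (θ i)) ?_
      exact continuous_finsetProd _ fun i _ => (hκ i).comp (continuous_apply i)
    have hmp := measurePreserving_piFinSuccAbove (fun _ : Fin (n + 1) => arcMeasure) 0
    rw [← hmp.symm.integral_comp (MeasurableEquiv.measurableEmbedding _), integral_prod]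
    · have hinner : ∀ x : ℝ, ∫ y : Fin n → ℝ,
          (fun θ : Fin (n + 1) → ℝ => f (fun i => γ i (θ i)) * ∏ i, κ i (θ i))
            ((MeasurableEquiv.piFinSuccAbove (fun _ => ℝ) 0).symm (x, y))
            ∂(Measure.pi fun _ => arcMeasure) =
          f (Function.update z 0 (γ 0 x)) * κ 0 x := by
        intro x
        have h1 := ih (D := fun i => D i.succ) (γ := fun i => γ i.succ) (κ := fun i => κ i.succ)
          (fun i => hγ _) (fun i => hγD _) (fun i => hκ _) (z := fun i => z i.succ)
          (fun i => hz _) (f := fun y => f (Fin.cons (γ 0 x) y))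
          (hf.comp (by fun_prop) fun y hy => hcons _ (hγD 0 x) y hy)
          (fun i y hy => by
            have := hrep i.succ _ (hcons _ (hγD 0 x) y hy)
            simpa only [Fin.cons_update] using this)
        have h2 : Function.update z 0 (γ 0 x) = Fin.cons (γ 0 x) (fun i => z i.succ) := by
          funext i
          refine Fin.cases ?_ (fun i => ?_) i
          · simp
          · simp
        rw [h2, ← h1, ← integral_mul_const]
        refine integral_congr_ae (Eventually.of_forall fun y => ?_)
        have h3 : (MeasurableEquiv.piFinSuccAbove (fun _ : Fin (n + 1) => ℝ) 0).symm (x, y) =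
            Fin.cons x y := by
          rw [← Fin.insertNth_zero']
          rfl
        have h4 : (fun i => γ i ((Fin.cons x y : Fin (n + 1) → ℝ) i)) =
            (Fin.cons (γ 0 x) (fun i : Fin n => γ i.succ (y i)) : Fin (n + 1) → ℂ) := by
          funext i
          refine Fin.cases ?_ (fun i => ?_) i <;> simp
        simp only [h3, h4, Fin.prod_univ_succ, Fin.cons_zero, Fin.cons_succ]
        ring
      simp only [hinner]
      rw [hrep 0 z (fun i _ => hz i), Function.update_eq_self]
    · exact (hmp.symm.integrable_comp_emb (MeasurableEquiv.measurableEmbedding _)).2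
        (integrable_pi_arcMeasure hcont)

/-! ### The Poisson multiplier -/

theorem continuous_poissonKernel_circleMap {ρ : ℝ} (hρ0 : 0 ≤ ρ) (hρ : ρ < 1) :
    Continuous fun θ => poissonKernel 0 (ρ : ℂ) (circleMap 0 1 θ) := by
  simp only [poissonKernel_def, sub_zero]
  have hc := continuous_circleMap 0 1
  refine Continuous.div (by fun_prop) (by fun_prop) fun θ => pow_ne_zero 2 (norm_ne_zero_iff.2 ?_)
  intro h
  have h1 : ‖circleMap 0 1 θ‖ = ‖(ρ : ℂ)‖ := by rw [sub_eq_zero.1 h]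
  rw [norm_circleMap_zero_of_pos one_pos, Complex.norm_real, Real.norm_of_nonneg hρ0] at h1
  linarith

theorem poissonKernel_circleMap_nonneg {ρ : ℝ} (hρ0 : 0 ≤ ρ) (hρ : ρ < 1) (θ : ℝ) :
    0 ≤ poissonKernel 0 (ρ : ℂ) (circleMap 0 1 θ) := by
  rw [poissonKernel_def, sub_zero, sub_zero, norm_circleMap_zero_of_pos one_pos, Complex.norm_real,
    Real.norm_of_nonneg hρ0]
  refine div_nonneg ?_ (sq_nonneg _)
  nlinarith

theorem integral_poissonKernel_mul_pow {ρ : ℝ} (hρ0 : 0 ≤ ρ) (hρ : ρ < 1) (j : ℕ) :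
    ∫ θ, (poissonKernel 0 (ρ : ℂ) (circleMap 0 1 θ) : ℂ) * circleMap 0 1 θ ^ j ∂arcMeasure =
      (ρ : ℂ) ^ j := by
  have hd : DiffContOnCl ℂ (fun z : ℂ => z ^ j) (Metric.ball 0 1) :=
    (differentiable_id.pow j).diffContOnCl
  rw [← hd.circleAverage_poissonKernel_smul (w := (ρ : ℂ)) (by simpa [abs_of_nonneg hρ0] using hρ),
    ← integral_arcMeasure_circleMap]
  rfl

theorem integral_poissonKernel {ρ : ℝ} (hρ0 : 0 ≤ ρ) (hρ : ρ < 1) :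
    ∫ θ, poissonKernel 0 (ρ : ℂ) (circleMap 0 1 θ) ∂arcMeasure = 1 := by
  have h1 := integral_poissonKernel_mul_pow hρ0 hρ 0
  simp only [pow_zero, mul_one] at h1
  rw [integral_complex_ofReal] at h1
  exact_mod_cast h1

/-- The Fourier coefficients of the Poisson kernel, `ρ ^ |n - k|` (the exponent is written with
truncated subtraction). -/
theorem integral_poissonKernel_mul_pow_mul_conj_pow {ρ : ℝ} (hρ0 : 0 ≤ ρ) (hρ : ρ < 1) (n k : ℕ) :
    ∫ θ, (poissonKernel 0 (ρ : ℂ) (circleMap 0 1 θ) : ℂ) *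
      (circleMap 0 1 θ ^ n * starRingEnd ℂ (circleMap 0 1 θ) ^ k) ∂arcMeasure =
      (ρ : ℂ) ^ ((n - k) + (k - n)) := by
  have hone : ∀ θ, circleMap 0 1 θ * starRingEnd ℂ (circleMap 0 1 θ) = 1 := by
    intro θ
    rw [Complex.mul_conj, Complex.normSq_eq_norm_sq, norm_circleMap_zero_of_pos one_pos]
    simp
  rcases le_total k n with hkn | hkn
  · obtain ⟨j, rfl⟩ := Nat.exists_eq_add_of_le hkn
    have h1 : ∀ θ, circleMap 0 1 θ ^ (k + j) * starRingEnd ℂ (circleMap 0 1 θ) ^ k =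
        circleMap 0 1 θ ^ j := by
      intro θ
      calc _ = (circleMap 0 1 θ * starRingEnd ℂ (circleMap 0 1 θ)) ^ k * circleMap 0 1 θ ^ j := by
            ring
        _ = _ := by rw [hone, one_pow, one_mul]
    simp only [h1]
    rw [integral_poissonKernel_mul_pow hρ0 hρ]
    congr 1
    omega
  · obtain ⟨j, rfl⟩ := Nat.exists_eq_add_of_le hkn
    have h1 : ∀ θ, (poissonKernel 0 (ρ : ℂ) (circleMap 0 1 θ) : ℂ) *
        (circleMap 0 1 θ ^ n * starRingEnd ℂ (circleMap 0 1 θ) ^ (n + j)) =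
        starRingEnd ℂ ((poissonKernel 0 (ρ : ℂ) (circleMap 0 1 θ) : ℂ) * circleMap 0 1 θ ^ j) := by
      intro θ
      rw [map_mul, Complex.conj_ofReal, map_pow]
      congr 1
      calc _ = (circleMap 0 1 θ * starRingEnd ℂ (circleMap 0 1 θ)) ^ n *
            starRingEnd ℂ (circleMap 0 1 θ) ^ j := by ring
        _ = _ := by rw [hone, one_pow, one_mul]
    simp only [h1]
    rw [integral_conj, integral_poissonKernel_mul_pow hρ0 hρ, map_pow, Complex.conj_ofReal]
    congr 1
    omega

/-- The multiplier `ρ ^ |n - k|` does not increase the supremum norm on the unit circle, since it is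
convolution with a rotated Poisson kernel. -/
theorem norm_tsum_mul_pow_dist_le {b : ℕ → ℂ} (hb : Summable fun n => ‖b n‖) {M : ℝ}
    (hM : ∀ w : ℂ, ‖w‖ = 1 → ‖∑' n, b n * w ^ n‖ ≤ M) {ρ : ℝ} (hρ0 : 0 ≤ ρ) (hρ : ρ < 1) (k : ℕ) :
    ‖∑' n, b n * (ρ : ℂ) ^ ((n - k) + (k - n))‖ ≤ M := by
  set p : ℝ → ℝ := fun θ => poissonKernel 0 (ρ : ℂ) (circleMap 0 1 θ) with hp
  have hpc : Continuous p := continuous_poissonKernel_circleMap hρ0 hρ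
  have hp0 : ∀ θ, 0 ≤ p θ := poissonKernel_circleMap_nonneg hρ0 hρ
  have hcm : Continuous (circleMap 0 1) := continuous_circleMap 0 1
  have hn : ∀ θ, ‖circleMap 0 1 θ‖ = 1 := norm_circleMap_zero_of_pos one_pos
  have hnorm : ∀ n θ, ‖b n * ((p θ : ℂ) * (circleMap 0 1 θ ^ n *
      starRingEnd ℂ (circleMap 0 1 θ) ^ k))‖ = ‖b n‖ * p θ := by
    intro n θ
    simp only [norm_mul, norm_pow, RCLike.norm_conj, hn, one_pow, mul_one, Complex.norm_real,
      Real.norm_of_nonneg (hp0 θ)]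
  have hsum : HasSum (fun n => ∫ θ, b n * ((p θ : ℂ) * (circleMap 0 1 θ ^ n *
      starRingEnd ℂ (circleMap 0 1 θ) ^ k)) ∂arcMeasure)
      (∫ θ, (∑' n, b n * circleMap 0 1 θ ^ n) * ((p θ : ℂ) *
        starRingEnd ℂ (circleMap 0 1 θ) ^ k) ∂arcMeasure) := by
    refine hasSum_integral_of_dominated_convergence (fun n θ => ‖b n‖ * p θ) (fun n => ?_)
      (fun n => Eventually.of_forall fun θ => (hnorm n θ).le)
      (Eventually.of_forall fun θ => hb.mul_right _) ?_ (Eventually.of_forall fun θ => ?_)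
    · have : Continuous fun θ => starRingEnd ℂ (circleMap 0 1 θ) := Complex.continuous_conj.comp hcm
      exact Continuous.aestronglyMeasurable (by fun_prop)
    · simp only [tsum_mul_right]
      exact (integrable_arcMeasure hpc).const_mul _
    · have h1 : Summable fun n => b n * circleMap 0 1 θ ^ n :=
        Summable.of_norm (by simpa [hn] using hb)
      refine (h1.hasSum.mul_right ((p θ : ℂ) * starRingEnd ℂ (circleMap 0 1 θ) ^ k)).congr_fun
        fun n => ?_
      ring
  have h1 : ∀ n, ∫ θ, b n * ((p θ : ℂ) * (circleMap 0 1 θ ^ n *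
      starRingEnd ℂ (circleMap 0 1 θ) ^ k)) ∂arcMeasure =
      b n * (ρ : ℂ) ^ ((n - k) + (k - n)) := by
    intro n
    rw [integral_const_mul, integral_poissonKernel_mul_pow_mul_conj_pow hρ0 hρ]
  simp only [h1] at hsum
  rw [hsum.tsum_eq]
  calc _ ≤ ∫ θ, M * p θ ∂arcMeasure := by
        refine norm_integral_le_of_norm_le ((integrable_arcMeasure hpc).const_mul M)
          (Eventually.of_forall fun θ => ?_)
        simp only [norm_mul, norm_pow, RCLike.norm_conj, hn, one_pow, mul_one, Complex.norm_real,
          Real.norm_of_nonneg (hp0 θ)]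
        exact mul_le_mul_of_nonneg_right (hM _ (hn θ)) (hp0 θ)
    _ = M := by rw [integral_const_mul, integral_poissonKernel hρ0 hρ, mul_one]

/-! ### Products of power series -/

theorem summable_norm_coeff_prod {R : Type*} [NormedCommRing R] [CompleteSpace R]
    {ι : Type*} (s : Finset ι) {a : ι → ℕ → R}
    (ha : ∀ i, Summable fun n => ‖a i n‖) :
    (Summable fun n => ‖PowerSeries.coeff n (∏ i ∈ s, PowerSeries.mk (a i))‖) ∧
      ∑' n, PowerSeries.coeff n (∏ i ∈ s, PowerSeries.mk (a i)) = ∏ i ∈ s, ∑' n, a i n := by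
  classical
  induction s using Finset.induction_on with
  | empty =>
    have h1 : ∀ n, PowerSeries.coeff n (∏ i ∈ (∅ : Finset ι), PowerSeries.mk (a i)) =
        if n = 0 then 1 else 0 := fun n => by rw [Finset.prod_empty, PowerSeries.coeff_one]
    simp only [h1]
    constructor
    · refine summable_of_ne_finset_zero (s := {0}) fun n hn => ?_
      rw [if_neg (by simpa using hn), norm_zero]
    · rw [tsum_ite_eq, Finset.prod_empty]
  | insert i s his ih =>
    set g : ℕ → R := fun n => PowerSeries.coeff n (∏ i ∈ s, PowerSeries.mk (a i)) with hg
    have h1 : ∀ n, PowerSeries.coeff n (∏ i ∈ insert i s, PowerSeries.mk (a i)) =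
        ∑ kl ∈ Finset.HasAntidiagonal.antidiagonal n, a i kl.1 * g kl.2 := fun n => by
      rw [Finset.prod_insert his, PowerSeries.coeff_mul]
      simp only [PowerSeries.coeff_mk, hg]
    simp only [h1]
    refine ⟨summable_norm_sum_mul_antidiagonal_of_summable_norm (ha i) ih.1, ?_⟩
    rw [← tsum_mul_tsum_eq_tsum_sum_antidiagonal_of_summable_norm (ha i) ih.1, ih.2,
      Finset.prod_insert his]

/-- The product of finitely many absolutely convergent series, arranged by total degree. -/
theorem hasSum_sum_finsuppAntidiag_prod {R : Type*} [NormedCommRing R] [CompleteSpace R]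
    {n : ℕ} {a : Fin n → ℕ → R} (ha : ∀ i, Summable fun n => ‖a i n‖) :
    HasSum (fun k => ∑ l ∈ (Finset.univ : Finset (Fin n)).finsuppAntidiag k, ∏ i, a i (l i))
      (∏ i, ∑' n, a i n) := by
  obtain ⟨h1, h2⟩ := summable_norm_coeff_prod Finset.univ ha
  rw [← h2]
  refine h1.of_norm.hasSum.congr_fun fun k => ?_
  rw [PowerSeries.coeff_prod]
  simp only [PowerSeries.coeff_mk]

end Torus

/-! ### Expansion of torus integrals against products of kernels -/

section TorusExpansion

open MeasureTheory

variable {m : ℕ} {a : Fin m → ℕ → ℂ} {κ : Fin m → ℂ → ℂ} {H : (Fin m → ℝ) → ℂ} {M r : ℝ}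

/-- The homogeneous part of degree `k` of the expansion of `∫ H ∏ᵢ κᵢ`, where the kernels have the
expansions `κᵢ(w) = ∑ₙ aᵢₙ w⁻ⁿ` and the integral is over the torus of radius `r`. -/
noncomputable def torusCoeff (H : (Fin m → ℝ) → ℂ) (r : ℝ) (a : Fin m → ℕ → ℂ) (k : ℕ) : ℂ :=
  ∑ l ∈ (Finset.univ : Finset (Fin m)).finsuppAntidiag k, (∏ i, a i (l i)) *
    ∫ θ, H θ * ∏ i, (circleMap 0 r (θ i))⁻¹ ^ l i ∂(Measure.pi fun _ => arcMeasure)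

/-- Rescaling the torus by `s⁻¹` multiplies the part of degree `k` of the expansion by `s ^ k`. -/
theorem hasSum_torusCoeff_mul_pow (hH : Continuous H) (hM : ∀ θ, ‖H θ‖ ≤ M)
    (ha : ∀ i, ∀ u : ℂ, u ≠ 0 → ‖u‖ < 1 → HasSum (fun n => a i n * u ^ n) (κ i u⁻¹))
    {s : ℂ} (hs : s ≠ 0) (hsr : ‖s‖ < r) :
    (Summable fun k => ‖torusCoeff H r a k * s ^ k‖) ∧
      HasSum (fun k => torusCoeff H r a k * s ^ k)
        (∫ θ, H θ * ∏ i, κ i (s⁻¹ * circleMap 0 r (θ i)) ∂(Measure.pi fun _ => arcMeasure)) := by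
  have hs0 : 0 < ‖s‖ := norm_pos_iff.2 hs
  have hr : 0 < r := hs0.trans hsr
  set q : ℝ := ‖s‖ / r with hq
  have hq0 : 0 < q := div_pos hs0 hr
  have hq1 : q < 1 := (div_lt_one hr).2 hsr
  have hv : ∀ t, circleMap 0 r t ≠ 0 := fun t => circleMap_ne_center hr.ne'
  have hu : ∀ t, ‖s * (circleMap 0 r t)⁻¹‖ = q := fun t => by
    rw [norm_mul, norm_inv, norm_circleMap_zero_of_pos hr, ← div_eq_mul_inv]
  have haq : ∀ i, Summable fun n => ‖‖a i n‖ * q ^ n‖ := by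
    intro i
    have h1 := (ha i (q : ℂ) (by exact_mod_cast hq0.ne')
      (by rwa [Complex.norm_real, Real.norm_of_nonneg hq0.le])).summable.norm
    refine h1.congr fun n => ?_
    simp [abs_of_pos hq0]
  -- the part of degree `k` of the integrand, and its bound, which is uniform over the torus
  set F : ℕ → (Fin m → ℝ) → ℂ := fun k θ =>
    ∑ l ∈ (Finset.univ : Finset (Fin m)).finsuppAntidiag k,
      H θ * ∏ i, (a i (l i) * (s * (circleMap 0 r (θ i))⁻¹) ^ l i) with hF
  set β : ℕ → ℝ := fun k => M * ∑ l ∈ (Finset.univ : Finset (Fin m)).finsuppAntidiag k,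
      ∏ i, (‖a i (l i)‖ * q ^ l i) with hβ
  have hβs : Summable β := (hasSum_sum_finsuppAntidiag_prod haq).summable.mul_left M
  have hcm : ∀ i, Continuous fun θ : Fin m → ℝ => (circleMap 0 r (θ i))⁻¹ := fun i =>
    ((continuous_circleMap 0 r).comp (continuous_apply i)).inv₀ fun θ => hv _
  have hterm : ∀ l : Fin m →₀ ℕ, Continuous fun θ : Fin m → ℝ =>
      H θ * ∏ i, (a i (l i) * (s * (circleMap 0 r (θ i))⁻¹) ^ l i) := fun l =>
    hH.mul (continuous_finsetProd _ fun i _ =>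
      continuous_const.mul ((continuous_const.mul (hcm i)).pow _))
  have hFβ : ∀ k θ, ‖F k θ‖ ≤ β k := by
    intro k θ
    rw [hβ, hF]
    simp only [Finset.mul_sum]
    refine norm_sum_le_of_le _ fun l _ => ?_
    rw [norm_mul, norm_prod]
    simp only [norm_mul (a _ _), norm_pow, hu]
    exact mul_le_mul_of_nonneg_right (hM θ) (by positivity)
  have hint : ∀ k, ∫ θ, F k θ ∂(Measure.pi fun _ => arcMeasure) = torusCoeff H r a k * s ^ k := by
    intro k
    rw [hF, torusCoeff, Finset.sum_mul]
    simp only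
    rw [integral_finsetSum _ fun l _ => integrable_pi_arcMeasure (hterm l)]
    refine Finset.sum_congr rfl fun l hl => ?_
    have hlk : ∑ i, l i = k := (Finset.mem_finsuppAntidiag.1 hl).1
    rw [mul_right_comm, ← integral_const_mul]
    congr 1
    funext θ
    rw [← hlk, ← Finset.prod_pow_eq_pow_sum]
    simp only [Finset.prod_mul_distrib, mul_pow]
    ring
  refine ⟨?_, ?_⟩
  · refine Summable.of_nonneg_of_le (fun _ => norm_nonneg _) (fun k => ?_) hβs
    rw [← hint]
    refine (norm_integral_le_of_norm_le_const (Eventually.of_forall (hFβ k))).trans_eq ?_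
    rw [probReal_univ, mul_one]
  · simp only [← hint]
    refine hasSum_integral_of_dominated_convergence (fun k _ => β k) (fun k => ?_)
      (fun k => Eventually.of_forall (hFβ k)) (Eventually.of_forall fun _ => hβs)
      (integrable_const _) (Eventually.of_forall fun θ => ?_)
    · exact (continuous_finsetSum _ fun l _ => hterm l).aestronglyMeasurable
    · have h1 : ∀ i, HasSum (fun n => a i n * (s * (circleMap 0 r (θ i))⁻¹) ^ n)
          (κ i (s⁻¹ * circleMap 0 r (θ i))) := by
        intro i
        have := ha i (s * (circleMap 0 r (θ i))⁻¹) (mul_ne_zero hs (inv_ne_zero (hv _)))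
          (by rwa [hu])
        rwa [mul_inv, inv_inv] at this
      have h2 := (hasSum_sum_finsuppAntidiag_prod fun i => (h1 i).summable.norm).mul_left (H θ)
      simp only [(h1 _).tsum_eq] at h2
      simpa only [hF, Finset.mul_sum] using h2

/-- A torus integral against a product of kernels is approximated by a weighted sum of the parts of
degree `≤ N` of its expansion. The weights come from the Poisson kernel; they are chosen so that the
error is `ρ ^ (N + 1)` times the rescaled expansion with multiplier `ρ ^ |n - N - 1|`, which costs no
factor depending on `N` or on `1 - ρ`. -/
theorem norm_integral_sub_sum_torusCoeff_le (hH : Continuous H) (hM : ∀ θ, ‖H θ‖ ≤ M)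
    (ha : ∀ i, ∀ u : ℂ, u ≠ 0 → ‖u‖ < 1 → HasSum (fun n => a i n * u ^ n) (κ i u⁻¹))
    {ρ : ℝ} (hρ0 : 0 < ρ) (hρ1 : ρ < 1) (hρr : 1 < ρ * r)
    (hκ : ∀ i, ContinuousOn (κ i) (Metric.sphere 0 (ρ * r))) (N : ℕ) :
    ‖(∫ θ, H θ * ∏ i, κ i (circleMap 0 r (θ i)) ∂(Measure.pi fun _ => arcMeasure)) -
      ∑ n ∈ Finset.range (N + 1), (1 - (ρ : ℂ) ^ (2 * (N + 1 - n))) * torusCoeff H r a n‖ ≤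
      ρ ^ (N + 1) * (M * ∏ i, Real.circleAverage (fun w => ‖κ i w‖) 0 (ρ * r)) := by
  have hM0 : 0 ≤ M := (norm_nonneg _).trans (hM 0)
  have hr0 : 0 < r := pos_of_mul_pos_right (one_pos.trans hρr) hρ0.le
  have hρr' : ρ⁻¹ < r := (inv_lt_iff_one_lt_mul₀' hρ0).2 hρr
  have hr1 : 1 < r := ((one_lt_inv₀ hρ0).2 hρ1).trans hρr'
  have hρc : (ρ : ℂ) ≠ 0 := by exact_mod_cast hρ0.ne'
  set B := torusCoeff H r a with hB
  -- the coefficients `b n` are those of the expansion rescaled to the torus of radius `ρ r`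
  set b : ℕ → ℂ := fun n => B n * (ρ : ℂ)⁻¹ ^ n with hb
  have hbs : Summable fun n => ‖b n‖ :=
    (hasSum_torusCoeff_mul_pow hH hM ha (inv_ne_zero hρc)
      (by rwa [norm_inv, Complex.norm_real, Real.norm_of_nonneg hρ0.le])).1
  have hbM : ∀ w : ℂ, ‖w‖ = 1 → ‖∑' n, b n * w ^ n‖ ≤
      M * ∏ i, Real.circleAverage (fun w => ‖κ i w‖) 0 (ρ * r) := by
    intro w hw
    have hw0 : w ≠ 0 := norm_ne_zero_iff.1 (by rw [hw]; exact one_ne_zero)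
    set s : ℂ := (ρ : ℂ)⁻¹ * w with hs
    have hsn : ‖s‖ = ρ⁻¹ := by
      rw [hs, norm_mul, hw, mul_one, norm_inv, Complex.norm_real, Real.norm_of_nonneg hρ0.le]
    have h1 := (hasSum_torusCoeff_mul_pow hH hM ha (mul_ne_zero (inv_ne_zero hρc) hw0)
      (by rwa [← hs, hsn])).2
    have h2 : ∀ n, b n * w ^ n = B n * s ^ n := fun n => by rw [hb, hs, mul_pow, mul_assoc]
    simp only [h2]
    rw [h1.tsum_eq]
    have hcont : ∀ i, Continuous fun t => ‖κ i (s⁻¹ * circleMap 0 r t)‖ := fun i =>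
      ((hκ i).comp_continuous (continuous_const.mul (continuous_circleMap 0 r)) fun t => by
        rw [mem_sphere_zero_iff_norm, Pi.mul_apply, norm_mul, norm_inv, hsn, inv_inv,
          norm_circleMap_zero_of_pos hr0]).norm
    refine (norm_integral_le_of_norm_le (g := fun θ : Fin m → ℝ =>
      M * ∏ i, ‖κ i (s⁻¹ * circleMap 0 r (θ i))‖) ?_ (Eventually.of_forall fun θ => ?_)).trans_eq ?_
    · exact (Integrable.fintype_prod (f := fun i t => ‖κ i (s⁻¹ * circleMap 0 r t)‖)
        fun i => integrable_arcMeasure (hcont i)).const_mul M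
    · rw [norm_mul, norm_prod]
      exact mul_le_mul_of_nonneg_right (hM θ) (by positivity)
    · rw [integral_const_mul,
        integral_fintype_prod_eq_prod (fun i t => ‖κ i (s⁻¹ * circleMap 0 r t)‖)]
      congr 1
      refine Finset.prod_congr rfl fun i _ => ?_
      rw [integral_arcMeasure_mul_circleMap (fun w => ‖κ i w‖), norm_inv, hsn, inv_inv]
  have h1 := norm_tsum_mul_pow_dist_le hbs hbM hρ0.le hρ1 (N + 1)
  have h2 : HasSum (fun n => B n)
      (∫ θ, H θ * ∏ i, κ i (circleMap 0 r (θ i)) ∂(Measure.pi fun _ => arcMeasure)) := by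
    simpa using (hasSum_torusCoeff_mul_pow hH hM ha one_ne_zero (by rwa [norm_one])).2
  -- for `n > N` the truncated exponent vanishes, and so does the weight
  have h3 : HasSum (fun n => (1 - (ρ : ℂ) ^ (2 * (N + 1 - n))) * B n)
      (∑ n ∈ Finset.range (N + 1), (1 - (ρ : ℂ) ^ (2 * (N + 1 - n))) * B n) := by
    refine hasSum_sum_of_ne_finset_zero fun n hn => ?_
    rw [Nat.sub_eq_zero_of_le (by simpa using hn), mul_zero, pow_zero, sub_self, zero_mul]
  have h4 : ∀ n, B n - (1 - (ρ : ℂ) ^ (2 * (N + 1 - n))) * B n =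
      (ρ : ℂ) ^ (N + 1) * (b n * (ρ : ℂ) ^ ((n - (N + 1)) + (N + 1 - n))) := by
    intro n
    have h5 : (ρ : ℂ) ^ (N + 1) * (ρ : ℂ) ^ ((n - (N + 1)) + (N + 1 - n)) =
        (ρ : ℂ) ^ (2 * (N + 1 - n)) * (ρ : ℂ) ^ n := by
      rw [← pow_add, ← pow_add]
      congr 1
      omega
    calc _ = B n * (ρ : ℂ) ^ (2 * (N + 1 - n)) := by ring
      _ = B n * (ρ : ℂ)⁻¹ ^ n * ((ρ : ℂ) ^ (2 * (N + 1 - n)) * (ρ : ℂ) ^ n) := by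
          rw [inv_pow]
          field_simp
      _ = _ := by
          rw [← h5, hb]
          ring
  have h5 := h2.sub h3
  simp only [h4] at h5
  rw [← h5.tsum_eq, tsum_mul_left, norm_mul, norm_pow, Complex.norm_real,
    Real.norm_of_nonneg hρ0.le]
  exact mul_le_mul_of_nonneg_left h1 (pow_nonneg hρ0.le _)

end TorusExpansion

/-! ### The approximating polynomial -/

section Polynomials

theorem totalDegree_toMvPolynomial_le {σ R : Type*} [CommSemiring R] [Nontrivial R] (i : σ) (p : Polynomial R) :
    (p.toMvPolynomial i).totalDegree ≤ p.natDegree := by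
  rw [Polynomial.toMvPolynomial, Polynomial.aeval_eq_sum_range]
  refine MvPolynomial.totalDegree_finsetSum_le fun k hk => ?_
  refine (MvPolynomial.totalDegree_smul_le _ _).trans ?_
  rw [MvPolynomial.totalDegree_X_pow]
  exact Nat.lt_succ_iff.1 (Finset.mem_range.1 hk)

/-- Linear combinations of the products `∏ᵢ Fᵢ,ₗᵢ(zᵢ)` with `∑ᵢ lᵢ ≤ N` are polynomials of total
degree at most `N`. -/
theorem exists_mvPolynomial_eval_eq {m : ℕ} {F : Fin m → ℕ → Polynomial ℂ}
    (hF : ∀ i n, (F i n).natDegree ≤ n) (N : ℕ) (ω : ℕ → ℂ) (c : (Fin m →₀ ℕ) → ℂ) :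
    ∃ P : MvPolynomial (Fin m) ℂ, P.totalDegree ≤ N ∧ ∀ z, MvPolynomial.eval z P =
      ∑ n ∈ Finset.range (N + 1), ω n *
        ∑ l ∈ (Finset.univ : Finset (Fin m)).finsuppAntidiag n,
          (∏ i, (F i (l i)).eval (z i)) * c l := by
  refine ⟨∑ n ∈ Finset.range (N + 1), MvPolynomial.C (ω n) *
        ∑ l ∈ (Finset.univ : Finset (Fin m)).finsuppAntidiag n,
          (∏ i, (F i (l i)).toMvPolynomial i) * MvPolynomial.C (c l), ?_, fun z => ?_⟩
  · refine MvPolynomial.totalDegree_finsetSum_le fun n hn => ?_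
    refine (MvPolynomial.totalDegree_mul _ _).trans ?_
    rw [MvPolynomial.totalDegree_C, zero_add]
    refine MvPolynomial.totalDegree_finsetSum_le fun l hl => ?_
    refine (MvPolynomial.totalDegree_mul _ _).trans ?_
    rw [MvPolynomial.totalDegree_C, add_zero]
    calc _ ≤ ∑ i, ((F i (l i)).toMvPolynomial i).totalDegree :=
          MvPolynomial.totalDegree_finsetProd _ _
      _ ≤ ∑ i, l i := Finset.sum_le_sum fun i _ =>
          (totalDegree_toMvPolynomial_le i _).trans (hF i _)
      _ = n := (Finset.mem_finsuppAntidiag.1 hl).1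
      _ ≤ N := Nat.lt_succ_iff.1 (Finset.mem_range.1 hn)
  · simp only [map_sum, map_mul, map_prod, MvPolynomial.eval_C, MvPolynomial.eval_toMvPolynomial]

end Polynomials

/-- The radius of the torus of integration: it is so close to `R` that passing from the exponent `N`
to `N + 1` absorbs the loss from `R` to `r`. -/
theorem exists_radius_div_pow_le {R R' : ℝ} (hR' : 0 < R') (hR : R' < R) (N : ℕ) :
    ∃ r, R' < r ∧ r < R ∧ (R' / r) ^ (N + 1) ≤ (R' / R) ^ N := by
  have hR0 : 0 < R := hR'.trans hR
  have h1 : Tendsto (fun r : ℝ => (R' / r) ^ (N + 1)) (𝓝[<] R) (𝓝 ((R' / R) ^ (N + 1))) :=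
    ((continuousAt_const.div continuousAt_id hR0.ne').pow _).tendsto.mono_left nhdsWithin_le_nhds
  have h2 : (R' / R) ^ (N + 1) < (R' / R) ^ N :=
    pow_lt_pow_right_of_lt_one₀ (div_pos hR' hR0) ((div_lt_one hR0).2 hR) (Nat.lt_succ_self N)
  obtain ⟨r, hr1, hr2, hr3⟩ := ((h1.eventually_lt_const h2).and
    (Ioo_mem_nhdsLT hR)).exists
  exact ⟨r, hr2, hr3, hr1.le⟩

theorem proposition6p1 (m : ℕ) :
    ∃ C : ℝ, 0 < C ∧
      ∀ K : Fin m → Set ℂ,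
        (∀ i, IsCompact (K i)) →
        (∀ i, (K i).Nontrivial) →
        (∀ i, IsSimplyConnected (((fun z : ℂ => (z : OnePoint ℂ)) '' K i)ᶜ : Set (OnePoint ℂ))) →
        ∀ (R : ℝ), 1 < R →
        ∀ f : (Fin m → ℂ) → ℂ,
          AnalyticOnNhd ℂ f (closure (Set.univ.pi fun i => levelDomain (K i) R)) →
          ∀ (N : ℕ) (R' : ℝ), 1 < R' → R' < R →
            ∃ P : MvPolynomial (Fin m) ℂ, P.totalDegree ≤ N ∧
              ∀ z ∈ Set.univ.pi K,
                ‖f z - MvPolynomial.eval z P‖ ≤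
                  C * (R' / R) ^ N *
                    (∏ i, levelCurveLength (K i) R' / setDist (K i) (levelCurve (K i) R')) *
                    sSup ((fun z => ‖f z‖) '' Set.univ.pi fun i => levelDomain (K i) R) := by
  refine ⟨1, one_pos, fun K hK hnt hsc R hR f hf N R' hR'1 hR'R => ?_⟩
  have h : ∀ i, IsExteriorMap (K i) (exteriorMap (K i)) := fun i =>
    isExteriorMap_exteriorMap (hK i) (hnt i) (hsc i)
  obtain ⟨r, hR'r, hrR, hrN⟩ := exists_radius_div_pow_le (one_pos.trans hR'1) hR'R N
  have hr1 : 1 < r := hR'1.trans hR'r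
  have hr0 : 0 < r := one_pos.trans hr1
  have hn : ∀ θ, ‖circleMap 0 r θ‖ = r := norm_circleMap_zero_of_pos hr0
  choose F hFdeg hFsum using fun i => exists_faberPolynomials (hK i) (h i)
  -- the open domains `D i` are the `G_{Kᵢ,R}` described through the exterior map
  set D : Fin m → Set ℂ := fun i => levelInterior (K i) R with hD
  have hDl : univ.pi D ⊆ univ.pi fun i => levelDomain (K i) R := fun y hy i hi =>
    levelInterior_subset_levelDomain (hK i) (h i) hR (hy i hi)
  have hfc : ContinuousOn f (univ.pi D) := hf.continuousOn.mono (hDl.trans subset_closure)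
  set M : ℝ := sSup ((fun z => ‖f z‖) '' univ.pi fun i => levelDomain (K i) R) with hMdef
  have hfM : ∀ y ∈ univ.pi D, ‖f y‖ ≤ M := by
    intro y hy
    have hcpt : IsCompact (closure (univ.pi fun i => levelDomain (K i) R)) :=
      (Bornology.IsBounded.pi fun i => isBounded_levelDomain (hK i) (h i) hR).isCompact_closure
    exact le_csSup ((hcpt.bddAbove_image hf.continuousOn.norm).mono (image_mono subset_closure))
      (mem_image_of_mem _ (hDl hy))
  set γ : Fin m → ℝ → ℂ := fun i t => exteriorInv (K i) (circleMap 0 r t) with hγ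
  have hγc : ∀ i, Continuous (γ i) := fun i => continuous_exteriorInv_circleMap (hK i) (h i) hr1
  have hγD : ∀ i t, γ i t ∈ D i := fun i t =>
    exteriorInv_mem_levelInterior (h i) (by rwa [hn]) (by rwa [hn])
  set H : (Fin m → ℝ) → ℂ := fun θ => f fun i => γ i (θ i) with hH
  have hHc : Continuous H := hfc.comp_continuous (by fun_prop) fun θ i _ => hγD i (θ i)
  have hHM : ∀ θ, ‖H θ‖ ≤ M := fun θ => hfM _ fun i _ => hγD i (θ i)
  have hM0 : 0 ≤ M := (norm_nonneg _).trans (hHM 0)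
  set ρ : ℝ := R' / r with hρ
  have hρ0 : 0 < ρ := div_pos (one_pos.trans hR'1) hr0
  have hρ1 : ρ < 1 := (div_lt_one hr0).2 hR'r
  have hρr : ρ * r = R' := div_mul_cancel₀ _ hr0.ne'
  obtain ⟨P, hPdeg, hP⟩ := exists_mvPolynomial_eval_eq hFdeg N
    (fun n => 1 - (ρ : ℂ) ^ (2 * (N + 1 - n)))
    (fun l => ∫ θ, H θ * ∏ i, (circleMap 0 r (θ i))⁻¹ ^ l i
      ∂(MeasureTheory.Measure.pi fun _ => arcMeasure))
  refine ⟨P, hPdeg, fun z hz => ?_⟩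
  have hκ : ∀ i, ContinuousOn (levelKernel (K i) (z i)) {w | 1 < ‖w‖} := fun i =>
    (continuousOn_id.mul (differentiableOn_deriv_exteriorInv (hK i) (h i)).continuousOn).div
      ((differentiableOn_exteriorInv (hK i) (h i)).continuousOn.sub continuousOn_const)
      fun w hw => sub_ne_zero.2 fun hwz =>
        exteriorInv_notMem (h i) hw (hwz ▸ hz i trivial)
  have hsph : ∀ s, 1 < s → Metric.sphere (0 : ℂ) s ⊆ {w | 1 < ‖w‖} := fun s hs w hw => by
    rw [mem_sphere_zero_iff_norm] at hw
    exact hs.trans_eq hw.symm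
  have hfz : ∫ θ, H θ * ∏ i, levelKernel (K i) (z i) (circleMap 0 r (θ i))
      ∂(MeasureTheory.Measure.pi fun _ => arcMeasure) = f z := by
    refine integral_pi_mul_prod_eq (κ := fun i t => levelKernel (K i) (z i) (circleMap 0 r t))
      hγc hγD (fun i => continuous_comp_circleMap hr0.le ((hκ i).mono (hsph r hr1)))
      (fun i => subset_levelInterior R (hz i trivial)) hfc fun i y hy => ?_
    have hupd : ∀ ζ ∈ D i, Function.update y i ζ ∈ univ.pi D := by
      intro ζ hζ j _
      rcases eq_or_ne j i with rfl | hj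
      · simpa using hζ
      · simpa [Function.update_of_ne hj] using hy j trivial
    have hdiff : DifferentiableOn ℂ (fun ζ => f (Function.update y i ζ)) (D i) := by
      intro ζ hζ
      refine DifferentiableAt.differentiableWithinAt ?_
      exact (hf _ (subset_closure (hDl (hupd ζ hζ)))).differentiableAt.comp ζ
        (hasDerivAt_update y i ζ).differentiableAt
    rw [← circleAverage_mul_levelKernel (hK i) (h i) hr1 hrR hdiff (hz i trivial),
      ← integral_arcMeasure_circleMap]
  have hmain := norm_integral_sub_sum_torusCoeff_le (a := fun i n => (F i n).eval (z i))
    (κ := fun i => levelKernel (K i) (z i)) hHc hHM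
    (fun i u hu hu1 => hFsum i (z i) (hz i trivial) u hu hu1) hρ0 hρ1 (by rwa [hρr])
    (fun i => (hκ i).mono (by rw [hρr]; exact hsph R' hR'1)) N
  rw [hfz, hρr] at hmain
  rw [hP]
  refine hmain.trans ?_
  have havg : ∀ i, 0 ≤ Real.circleAverage (fun w => ‖levelKernel (K i) (z i) w‖) 0 R' := fun i =>
    Real.circleAverage_nonneg_of_nonneg fun w _ => norm_nonneg _
  have hprod : ∏ i, Real.circleAverage (fun w => ‖levelKernel (K i) (z i) w‖) 0 R' ≤
      ∏ i, levelCurveLength (K i) R' / setDist (K i) (levelCurve (K i) R') :=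
    Finset.prod_le_prod (fun i _ => havg i) fun i _ =>
      circleAverage_norm_levelKernel_le (hK i) (h i) hR'1 (hz i trivial)
  calc _ ≤ (R' / R) ^ N * (M *
        ∏ i, levelCurveLength (K i) R' / setDist (K i) (levelCurve (K i) R')) := by
        refine mul_le_mul hrN (mul_le_mul_of_nonneg_left hprod hM0)
          (mul_nonneg hM0 (Finset.prod_nonneg fun i _ => havg i)) ?_
        have : 0 < R := one_pos.trans hR
        positivity
    _ = _ := by ring
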